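/- Conventions. All modules are $\mathbb Z_2$-graded left modules, and $\mathrm{Gr}\,A$ is the category of graded modules over a superalgebra $A$ with even (degree-preserving) $A$-linear maps; an irreducible graded module is a non-zero one with no graded submodules other than $0$ and itself. The suspension $\sigma(M)$ is the same $A$-module with $\sigma(M)_i=M_{i+1}$. For non-negative integers $p,q$, $\mathbb R_{p,q}$ is the real superalgebra generated by anticommuting odd elements, $p$ of square $1$ and $q$ of square $-1$; $\mathbb C_{p,0}$ is the complex superalgebra generated by $p$ anticommuting odd elements of square $1$. The algebras $\mathbb R,\mathbb H,\mathbb C$ are regarded as superalgebras concentrated in degree $0$. Superalgebras $A$ and $B$ over a field are graded Morita equivalent, $A\approx B$, if $\mathrm{Gr}\,A$ and $\mathrm{Gr}\,B$ are equivalent categories and $B\cong \mathrm{Hom}_{\mathrm{Gr}A}(P,P)\oplus\mathrm{Hom}_{\mathrm{Gr}A}(\sigma(P),P)$ as superalgebras for some finitely generated projective graded $A$-module $P$, where endomorphisms are multiplied as right operators ($fg$ means first $f$, then $g$). Theorem. (1) Let $p,q\ge 0$ be integers. Define a superalgebra $B$ and a set $I$ of graded $B$-modules by $$\begin{array}{c|cccccccc}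 p-q \bmod 8&0&1&2&3&4&5&6&7\\ \hline B&\mathbb R&\mathbb R_{1,0}&\mathbb R_{2,0}&\mathbb R_{3,0}&\mathbb H&\mathbb R_{0,3}&\mathbb R_{0,2}&\mathbb R_{0,1}\\ I&\{\mathbb R,\sigma(\mathbb R)\}&\{\mathbb R_{1,0}\}&\{\mathbb R_{2,0}\}&\{\mathbb R_{3,0}\}&\{\mathbb H,\sigma(\mathbb H)\}&\{\mathbb R_{0,3}\}&\{\mathbb R_{0,2}\}&\{\mathbb R_{0,1}\} \end{array}$$ Then $\mathbb R_{p,q}\approx B$, and under every equivalence $\mathrm{Gr}\,\mathbb R_{p,q}\simeq\mathrm{Gr}\,B$ the irreducible graded $\mathbb R_{p,q}$-modules are exactly those that correspond, up to isomorphism, to a member of $I$. The number of isomorphism classes in $\mathrm{Gr}\,\mathbb R_{p,q}$ of irreducible graded $\mathbb R_{p,q}$-modules is $2$ if $p-q\equiv 0\pmod 4$ and $1$ otherwise. The Grothendieck group of the category of finite-dimensional graded $\mathbb R_{p,q}$-modules is isomorphic to $\mathbb Z\oplus\mathbb Z$ if $p-q\equiv0\pmod 4$ and to $\mathbb Z$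 otherwise, in such a way that the classes of the irreducible modules form the standard basis. (2) Let $p\ge 0$ be an integer. Put $B=\mathbb C$, $I=\{\mathbb C,\sigma(\mathbb C)\}$ if $p$ is even, and $B=\mathbb C_{1,0}$, $I=\{\mathbb C_{1,0}\}$ if $p$ is odd. Then $\mathbb C_{p,0}\approx B$, and under every equivalence $\mathrm{Gr}\,\mathbb C_{p,0}\simeq\mathrm{Gr}\,B$ the irreducible graded $\mathbb C_{p,0}$-modules are exactly those that correspond, up to isomorphism, to a member of $I$. The number of isomorphism classes in $\mathrm{Gr}\,\mathbb C_{p,0}$ of irreducible graded $\mathbb C_{p,0}$-modules is $2$ if $p$ is even and $1$ if $p$ is odd, and the Grothendieck group of the category of finite-dimensional graded $\mathbb C_{p,0}$-modules is isomorphic to $\mathbb Z\oplus\mathbb Z$, respectively $\mathbb Z$, in such a way that the classes of the irreducible modules form the standard basis. -/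

import Mathlib

open CategoryTheory

/-- A superalgebra over a field `K`: a `ℤ/2`-graded associative unital `K`-algebra. -/
structure Superalgebra (K : Type) [Field K] where
  carrier : Type
  [ring : Ring carrier]
  [algebra : Algebra K carrier]
  deg : ZMod 2 → Submodule K carrier
  isCompl : IsCompl (deg 0) (deg 1)
  one_mem : (1 : carrier) ∈ deg 0
  mul_mem : ∀ {i j : ZMod 2} {a b : carrier}, a ∈ deg i → b ∈ deg j → a * b ∈ deg (i + j)

namespace Superalgebra

variable {K : Type} [Field K]

instance : CoeSort (Superalgebra K) Type := ⟨carrier⟩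

attribute [instance] Superalgebra.ring Superalgebra.algebra

/-- Two superalgebras are isomorphic if there is an even algebra isomorphism between them. -/
def IsIsomorphic (A B : Superalgebra K) : Prop :=
  ∃ φ : A ≃ₐ[K] B, ∀ (i : ZMod 2) (a : A), a ∈ A.deg i → φ a ∈ B.deg i

/-- A `K`-algebra viewed as a superalgebra concentrated in degree `0`. -/
def concentrated (K : Type) [Field K] (R : Type) [Ring R] [Algebra K R] : Superalgebra K where
  carrier := R
  deg i := if i = 0 then ⊤ else ⊥
  isCompl := by simpa using isCompl_top_bot
  one_mem := by simp
  mul_mem := by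
    intro i j a b ha hb
    by_cases hi : i = 0 <;> by_cases hj : j = 0 <;> simp_all

/-- The Clifford algebra of a quadratic form, with its even-odd grading. -/
def ofQuadraticForm {V : Type} [AddCommGroup V] [Module K V] (Q : QuadraticForm K V) :
    Superalgebra K where
  carrier := CliffordAlgebra Q
  deg := CliffordAlgebra.evenOdd Q
  isCompl := CliffordAlgebra.evenOdd_isCompl Q
  one_mem := SetLike.GradedOne.one_mem
  mul_mem := fun ha hb => SetLike.GradedMul.mul_mem ha hb

end Superalgebra

/-- The real Clifford superalgebra with `p` anticommuting odd generators of square `1` and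
`q` of square `-1`: the Clifford algebra of
`x₁² + ⋯ + x_p² - x_{p+1}² - ⋯ - x_{p+q}²` on `ℝ^{p+q}`
(with the convention `v * v = Q v`). -/
noncomputable def realClifford (p q : ℕ) : Superalgebra ℝ :=
  Superalgebra.ofQuadraticForm
    (QuadraticMap.weightedSumSquares ℝ
      (Sum.elim (fun _ => 1) (fun _ => -1) : Fin p ⊕ Fin q → ℝ))

/-- The complex Clifford superalgebra with `p` anticommuting odd generators of square `1`. -/
noncomputable def complexClifford (p : ℕ) : Superalgebra ℂ :=
  Superalgebra.ofQuadraticForm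
    (QuadraticMap.weightedSumSquares ℂ (fun _ => 1 : Fin p → ℂ))

/-- A `ℤ/2`-graded left module over a superalgebra. -/
structure GrModule {K : Type} [Field K] (A : Superalgebra K) where
  carrier : Type
  [addCommGroup : AddCommGroup carrier]
  [moduleBase : Module K carrier]
  [module : Module A carrier]
  [isScalarTower : IsScalarTower K A carrier]
  deg : ZMod 2 → Submodule K carrier
  isCompl : IsCompl (deg 0) (deg 1)
  smul_mem : ∀ {i j : ZMod 2} {a : A} {m : carrier},
    a ∈ A.deg i → m ∈ deg j → a • m ∈ deg (i + j)

namespace GrModule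

variable {K : Type} [Field K] {A : Superalgebra K}

instance : CoeSort (GrModule A) Type := ⟨carrier⟩

attribute [instance] GrModule.addCommGroup GrModule.moduleBase GrModule.module
  GrModule.isScalarTower

/-- The morphisms of `Gr A`: even `A`-linear maps. -/
@[ext]
structure Hom (M N : GrModule A) where
  toLinearMap : M →ₗ[A] N
  map_deg : ∀ (i : ZMod 2) (m : M), m ∈ M.deg i → toLinearMap m ∈ N.deg i

/-- The category `Gr A` of graded left `A`-modules and even homomorphisms. -/
instance : Category (GrModule A) where
  Hom := Hom
  id M := ⟨LinearMap.id, fun _ _ h => h⟩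
  comp f g := ⟨g.toLinearMap ∘ₗ f.toLinearMap, fun i m h => g.map_deg i _ (f.map_deg i m h)⟩

/-- The suspension `σ(M)`: the same `A`-module with `σ(M)ᵢ = Mᵢ₊₁`. -/
def suspension (M : GrModule A) : GrModule A where
  carrier := M
  deg i := M.deg (i + 1)
  isCompl := M.isCompl.symm
  smul_mem := by
    intro i j a m ha hm
    rw [add_assoc]
    exact M.smul_mem ha hm

/-- A superalgebra as a graded left module over itself. -/
def regular (A : Superalgebra K) : GrModule A where
  carrier := A
  deg := A.deg
  isCompl := A.isCompl
  smul_mem := A.mul_mem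

/-- A graded module is irreducible if it is non-zero and has no graded submodules other than
`0` and itself; a submodule is graded if it contains the homogeneous components of its
elements. -/
def IsIrreducible (M : GrModule A) : Prop :=
  Nontrivial M ∧ ∀ N : Submodule A M,
    (∀ x ∈ M.deg 0, ∀ y ∈ M.deg 1, x + y ∈ N → x ∈ N ∧ y ∈ N) → N = ⊥ ∨ N = ⊤

/-- The endomorphisms of degree `i`: the `A`-linear maps `f` with `f(M_j) ⊆ M_{j+i}`.
For `i = 0` these are the morphisms `M ⟶ M` of `Gr A`, for `i = 1` the morphisms
`σ(M) ⟶ M`. -/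
def endDeg (M : GrModule A) (i : ZMod 2) : Submodule K (Module.End A M) where
  carrier := {f | ∀ (j : ZMod 2) (m : M), m ∈ M.deg j → f m ∈ M.deg (j + i)}
  add_mem' hf hg j m hm := add_mem (hf j m hm) (hg j m hm)
  zero_mem' j _ _ := zero_mem (M.deg (j + i))
  smul_mem' c _ hf j m hm := (M.deg (j + i)).smul_mem c (hf j m hm)

theorem zero_or_one (i : ZMod 2) : i = 0 ∨ i = 1 := by
  revert i
  decide

theorem isCompl_add_one (M : GrModule A) (i : ZMod 2) : IsCompl (M.deg i) (M.deg (i + 1)) := by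
  fin_cases i
  · exact M.isCompl
  · exact M.isCompl.symm

/-- The projection `M → Mᵢ ⊆ M`. -/
noncomputable def proj (M : GrModule A) (i : ZMod 2) : M →ₗ[K] M :=
  (M.deg i).projection (M.deg (i + 1)) (M.isCompl_add_one i)

theorem proj_mem (M : GrModule A) (i : ZMod 2) (m : M) : M.proj i m ∈ M.deg i := by
  simp [proj]

theorem proj_of_mem (M : GrModule A) {i : ZMod 2} {m : M} (h : m ∈ M.deg i) :
    M.proj i m = m := by
  rw [proj, ← Submodule.coe_projectionOnto_apply,
    Submodule.projectionOnto_apply_of_mem_left _ h]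

theorem proj_of_mem_ne (M : GrModule A) {i j : ZMod 2} (hij : j ≠ i) {m : M}
    (h : m ∈ M.deg j) : M.proj i m = 0 := by
  have key : ∀ i j : ZMod 2, j ≠ i → j = i + 1 := by decide
  obtain rfl := key i j hij
  rw [proj, ← Submodule.coe_projectionOnto_apply,
    Submodule.projectionOnto_apply_of_mem_right _ h]
  rfl

theorem proj_add_proj (M : GrModule A) (m : M) : M.proj 0 m + M.proj 1 m = m := by
  obtain ⟨x, y, hx, hy, rfl⟩ :=
    Submodule.codisjoint_iff_exists_add_eq.1 M.isCompl.codisjoint m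
  simp only [map_add]
  rw [M.proj_of_mem hx, M.proj_of_mem hy, M.proj_of_mem_ne (by decide) hx,
    M.proj_of_mem_ne (by decide) hy]
  simp

theorem proj_smul (M : GrModule A) {i j : ZMod 2} {a : A} (ha : a ∈ A.deg j) (m : M) :
    M.proj (j + i) (a • m) = a • M.proj i m := by
  have h : ∀ k, k ≠ i → M.proj (j + i) (a • M.proj k m) = 0 := fun k hk =>
    M.proj_of_mem_ne (by simpa using hk) (M.smul_mem ha (M.proj_mem k m))
  have h' : M.proj (j + i) (a • M.proj i m) = a • M.proj i m :=
    M.proj_of_mem (M.smul_mem ha (M.proj_mem i m))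
  conv_lhs => rw [← M.proj_add_proj m]
  rw [smul_add, map_add]
  obtain rfl | rfl := zero_or_one i
  · rw [h 1 (by decide)]
    simpa using h'
  · rw [h 0 (by decide)]
    simpa using h'

/-- The degree `k` component of an endomorphism. -/
noncomputable def endComponent (M : GrModule A) (f : Module.End A M) (k : ZMod 2) :
    Module.End A M where
  toFun m := M.proj (0 + k) (f (M.proj 0 m)) + M.proj (1 + k) (f (M.proj 1 m))
  map_add' x y := by simp only [map_add]; abel
  map_smul' a m := by
    have key : ∀ (j : ZMod 2) (a : A), a ∈ A.deg j → ∀ i : ZMod 2,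
        M.proj (j + i + k) (f (M.proj (j + i) (a • m))) =
          a • M.proj (i + k) (f (M.proj i m)) := by
      intro j a ha i
      rw [M.proj_smul ha, map_smul, add_assoc, M.proj_smul ha]
    obtain ⟨x, y, hx, hy, rfl⟩ :=
      Submodule.codisjoint_iff_exists_add_eq.1 A.isCompl.codisjoint a
    have h0 := key 0 x hx 0
    have h1 := key 0 x hx 1
    have h2 := key 1 y hy 0
    have h3 := key 1 y hy 1
    rw [zero_add] at h0 h1
    rw [add_zero] at h2
    rw [show (1 : ZMod 2) + 1 = 0 from rfl] at h3
    simp only [add_smul, map_add, RingHom.id_apply, smul_add]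
    rw [h0, h1, h2, h3]
    abel

theorem endComponent_mem (M : GrModule A) (f : Module.End A M) (k : ZMod 2) :
    M.endComponent f k ∈ M.endDeg k := by
  intro j m hm
  change M.proj (0 + k) (f (M.proj 0 m)) + M.proj (1 + k) (f (M.proj 1 m)) ∈ _
  obtain rfl | rfl := zero_or_one j
  · have h1 : M.proj 1 m = 0 := M.proj_of_mem_ne (by decide) hm
    rw [h1]
    simpa using M.proj_mem k _
  · have h0 : M.proj 0 m = 0 := M.proj_of_mem_ne (by decide) hm
    rw [h0]
    simpa using M.proj_mem (1 + k) _

theorem endComponent_add (M : GrModule A) (f : Module.End A M) :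
    M.endComponent f 0 + M.endComponent f 1 = f := by
  ext m
  change M.proj (0 + 0) (f (M.proj 0 m)) + M.proj (1 + 0) (f (M.proj 1 m)) +
    (M.proj (0 + 1) (f (M.proj 0 m)) + M.proj (1 + 1) (f (M.proj 1 m))) = f m
  rw [show (1 : ZMod 2) + 1 = 0 from rfl, add_zero, add_zero, zero_add]
  conv_rhs => rw [← M.proj_add_proj m, map_add, ← M.proj_add_proj (f (M.proj 0 m)),
    ← M.proj_add_proj (f (M.proj 1 m))]
  abel

theorem isCompl_endDeg (M : GrModule A) : IsCompl (M.endDeg 0) (M.endDeg 1) := by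
  constructor
  · rw [Submodule.disjoint_def]
    intro f h0 h1
    have key : ∀ (j : ZMod 2) (m : M), m ∈ M.deg j → f m = 0 := fun j m hm => by
      have := Submodule.disjoint_def.1 (M.isCompl_add_one j).disjoint (f m)
      exact this (by simpa using h0 j m hm) (h1 j m hm)
    ext m
    rw [← M.proj_add_proj m, map_add, key 0 _ (M.proj_mem 0 m), key 1 _ (M.proj_mem 1 m)]
    simp
  · rw [Submodule.codisjoint_iff_exists_add_eq]
    exact fun f => ⟨_, _, M.endComponent_mem f 0, M.endComponent_mem f 1, M.endComponent_add f⟩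

/-- The twisted endomorphism superalgebra
`End_A^σ(M) = Hom_{Gr A}(M, M) ⊕ Hom_{Gr A}(σ(M), M)`. Endomorphisms of left modules are
multiplied as right operators (`f * g` is `f` followed by `g`), so that
`End_A^σ(A) ≅ A`. -/
def twistedEnd (M : GrModule A) : Superalgebra K where
  carrier := (Module.End A M)ᵐᵒᵖ
  deg i := (M.endDeg i).comap (MulOpposite.opLinearEquiv K).symm.toLinearMap
  isCompl := by
    have h := M.isCompl_endDeg
    constructor
    · rw [Submodule.disjoint_def]
      intro f h0 h1
      have := Submodule.disjoint_def.1 h.disjoint f.unop h0 h1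
      exact MulOpposite.unop_injective this
    · rw [Submodule.codisjoint_iff_exists_add_eq]
      intro f
      obtain ⟨x, y, hx, hy, hxy⟩ :=
        Submodule.codisjoint_iff_exists_add_eq.1 h.codisjoint f.unop
      exact ⟨.op x, .op y, hx, hy, MulOpposite.unop_injective hxy⟩
  one_mem := by
    intro j m hm
    simpa using hm
  mul_mem := by
    intro i j f g hf hg k m hm
    have := hg (k + i) _ (hf k m hm)
    rwa [add_assoc] at this

/-- The isomorphism classes of irreducible graded modules in `Gr A`. -/
def Irr (A : Superalgebra K) : Type 1 :=
  Quot (fun M N : {M : GrModule A // M.IsIrreducible} => Nonempty (M.1 ≅ N.1))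

/-- The finite dimensional graded `A`-modules. -/
abbrev FinDim (A : Superalgebra K) : Type 1 :=
  {M : GrModule A // FiniteDimensional K M}

/-- `0 → L → M → N → 0` is exact for some morphisms `L ⟶ M` and `M ⟶ N` of `Gr A`. -/
def IsExtension (L M N : GrModule A) : Prop :=
  ∃ (f : Hom L M) (g : Hom M N), Function.Injective f.toLinearMap ∧
    Function.Surjective g.toLinearMap ∧ Function.Exact f.toLinearMap g.toLinearMap

/-- The Grothendieck group of the category of finite dimensional graded `A`-modules:
generated by the modules, with the relation `[M] = [L] + [N]` for each short exact sequence
`0 → L → M → N → 0`. -/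
def GrothendieckGroup (A : Superalgebra K) : Type 1 :=
  FreeAbelianGroup (FinDim A) ⧸ AddSubgroup.closure
    {x : FreeAbelianGroup (FinDim A) | ∃ L M N : FinDim A, IsExtension L.1 M.1 N.1 ∧
      x = FreeAbelianGroup.of M - (FreeAbelianGroup.of L + FreeAbelianGroup.of N)}

noncomputable instance (A : Superalgebra K) : AddCommGroup (GrothendieckGroup A) :=
  inferInstanceAs (AddCommGroup (FreeAbelianGroup (FinDim A) ⧸ AddSubgroup.closure _))

/-- The class of a finite dimensional graded module in the Grothendieck group. -/
def GrothendieckGroup.mk (M : FinDim A) : GrothendieckGroup A :=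
  QuotientAddGroup.mk (FreeAbelianGroup.of M)

/-- The classes in the Grothendieck group of the irreducible graded modules. -/
def irreducibleClasses (A : Superalgebra K) : Set (GrothendieckGroup A) :=
  {x | ∃ M : FinDim A, M.1.IsIrreducible ∧ x = GrothendieckGroup.mk M}

/-- Under every equivalence `Gr A ≌ Gr B`, the irreducible graded `A`-modules are exactly the
modules that correspond, up to isomorphism in `Gr B`, to a member of `S`. -/
def IrreduciblesCorrespondTo (A B : Superalgebra K) (S : Set (GrModule B)) : Prop :=
  ∀ (F : GrModule A ≌ GrModule B) (M : GrModule A),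
    M.IsIrreducible ↔ ∃ N ∈ S, Nonempty (F.functor.obj M ≅ N)

end GrModule

/-- Graded Morita equivalence: the categories `Gr A` and `Gr B` are equivalent, and `B` is
isomorphic to `End_A^σ(P)` for some finitely generated projective graded `A`-module `P`. -/
def GradedMoritaEquivalent {K : Type} [Field K] (A B : Superalgebra K) : Prop :=
  Nonempty (GrModule A ≌ GrModule B) ∧
    ∃ P : GrModule A, Module.Finite A P ∧ Module.Projective A P ∧
      B.IsIsomorphic P.twistedEnd

/-- `A` is graded Morita equivalent to `B`; its irreducible graded modules correspond to
`B` and `σ(B)`; there are exactly two of them up to isomorphism; and the Grothendieck group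
is `ℤ ⊕ ℤ`, generated freely by their two classes. -/
def TwoIrreducibles {K : Type} [Field K] (A B : Superalgebra K) : Prop :=
  GradedMoritaEquivalent A B ∧
  GrModule.IrreduciblesCorrespondTo A B
    {GrModule.regular B, (GrModule.regular B).suspension} ∧
  Nat.card (GrModule.Irr A) = 2 ∧
  ∃ e : GrModule.GrothendieckGroup A ≃+ ℤ × ℤ, e '' GrModule.irreducibleClasses A = {(1, 0), (0, 1)}

/-- `A` is graded Morita equivalent to `B`; its irreducible graded modules correspond to `B`;
there is exactly one of them up to isomorphism; and the Grothendieck group is `ℤ`, generated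
freely by its class. -/
def OneIrreducible {K : Type} [Field K] (A B : Superalgebra K) : Prop :=
  GradedMoritaEquivalent A B ∧
  GrModule.IrreduciblesCorrespondTo A B {GrModule.regular B} ∧
  Nat.card (GrModule.Irr A) = 1 ∧
  ∃ e : GrModule.GrothendieckGroup A ≃+ ℤ, e '' GrModule.irreducibleClasses A = {1}

/-!
Call `B` a *full corner* of `A` when `B ≅ e A e` for an even idempotent `e` with `A e A = A`, the
latter being witnessed by a decomposition `1 = ∑ uᵢ e vᵢ` with homogeneous `uᵢ`, `vᵢ`. This relation
is transitive, and it yields everything claimed about a pair `A`, `B`.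

* It implies graded Morita equivalence. The functor `M ↦ e M` is an equivalence `Gr A ≌ Gr B`: it is
  full and faithful because `m = ∑ uᵢ e (vᵢ m)`, and essentially surjective because `A e ⊗_B N` can
  be written down as the image of an idempotent matrix acting on `Nⁿ`. The required module is
  `P = A e`, on which `B ≅ e A e` acts by right multiplication
  (`FullCorner.gradedMoritaEquivalent`).
* Irreducibility is expressed through subobjects, so every equivalence preserves and reflects it
  (`GrModule.isIrreducible_map_iff`).
* If every non-zero homogeneous element of `B` is invertible, then by Schur's lemma the irreducible
  `B`-modules are `B` and `σ(B)`, which are isomorphic exactly when `B₁ ≠ 0`. The Grothendieck group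
  is generated by the irreducible classes, by induction on the dimension, and the homomorphisms
  `[M] ↦ dim (e M)ᵢ` show that they are independent (`FullCorner.oneIrreducible`,
  `FullCorner.twoIrreducibles`).

It remains to find, in each Clifford algebra, the listed graded division algebra as a full corner.
Adding a hyperbolic plane `⟨1, -1⟩` to the form passes to an algebra with the old one as a full
corner (`diagClifford.nonempty_fullCorner_addPlane`), and multiplying four generators of square `1`
by their product `ω`, where `ω² = 1`, turns them into generators of square `-1`
(`diagClifford.nonempty_fullCorner_neg_four`). These two moves reduce every `ℝ_{p,q}` to one of
`ℝ_{a,0}` with `a ≤ 4` and `ℝ_{0,b}` with `b ≤ 3`, preserving `p - q` modulo `8`. Of these, the ones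
with one to three generators have the form `D ⊕ u D` with `D` one of `ℝ`, `ℂ`, `ℍ` in degree `0` and
`u` odd with `u² = ±1`, hence are graded division algebras, and `ℍ` is the full corner of `ℝ_{4,0}`
at `(1 + ω) / 2`. Over `ℂ` the form `⟨1, 1⟩` is itself a hyperbolic plane, so the period is `2`.
-/

/-! ### Graded modules: homogeneous components, submodules, quotients -/

namespace GrModule

variable {K : Type} [Field K] {A : Superalgebra K}

theorem mem_deg_iff (M : GrModule A) {i : ZMod 2} {m : M} : m ∈ M.deg i ↔ M.proj i m = m :=
  ⟨M.proj_of_mem, fun h => h ▸ M.proj_mem i m⟩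

theorem eq_zero_of_mem (M : GrModule A) {i : ZMod 2} {m : M} (h : m ∈ M.deg i)
    (h' : m ∈ M.deg (i + 1)) : m = 0 :=
  Submodule.disjoint_def.1 (M.isCompl_add_one i).disjoint m h h'

theorem Hom.map_proj {M N : GrModule A} (f : Hom M N) (i : ZMod 2) (m : M) :
    f.toLinearMap (M.proj i m) = N.proj i (f.toLinearMap m) := by
  have h : ∀ j, f.toLinearMap (M.proj j m) ∈ N.deg j := fun j => f.map_deg j _ (M.proj_mem j m)
  conv_rhs => rw [← M.proj_add_proj m, map_add, map_add]
  obtain rfl | rfl := zero_or_one i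
  · rw [N.proj_of_mem (h 0), N.proj_of_mem_ne (by decide) (h 1), add_zero]
  · rw [N.proj_of_mem (h 1), N.proj_of_mem_ne (by decide) (h 0), zero_add]

/-- A submodule is graded if it contains the homogeneous components of its elements. -/
def IsGraded {M : GrModule A} (N : Submodule A M) : Prop :=
  ∀ x ∈ M.deg 0, ∀ y ∈ M.deg 1, x + y ∈ N → x ∈ N ∧ y ∈ N

theorem isGraded_iff {M : GrModule A} {N : Submodule A M} :
    IsGraded N ↔ ∀ i, ∀ x ∈ N, M.proj i x ∈ N := by
  constructor
  · intro h i x hx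
    have := h _ (M.proj_mem 0 x) _ (M.proj_mem 1 x) (by rwa [M.proj_add_proj])
    obtain rfl | rfl := zero_or_one i
    exacts [this.1, this.2]
  · intro h x hx y hy hxy
    have h0 := h 0 _ hxy
    have h1 := h 1 _ hxy
    rw [map_add, M.proj_of_mem hx, M.proj_of_mem_ne (by decide) hy, add_zero] at h0
    rw [map_add, M.proj_of_mem hy, M.proj_of_mem_ne (by decide) hx, zero_add] at h1
    exact ⟨h0, h1⟩

theorem Hom.isGraded_ker {M N : GrModule A} (f : Hom M N) :
    IsGraded (LinearMap.ker f.toLinearMap) := by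
  rw [isGraded_iff]
  intro i x hx
  rw [LinearMap.mem_ker] at hx ⊢
  rw [f.map_proj, hx, map_zero]

theorem Hom.isGraded_range {M N : GrModule A} (f : Hom M N) :
    IsGraded (LinearMap.range f.toLinearMap) := by
  rw [isGraded_iff]
  rintro i _ ⟨x, rfl⟩
  exact ⟨M.proj i x, f.map_proj i x⟩

theorem isGraded_bot (M : GrModule A) : IsGraded (⊥ : Submodule A M) := by
  rw [isGraded_iff]
  rintro i x hx
  rw [(Submodule.mem_bot A).1 hx, map_zero]
  exact zero_mem _

/-- A graded submodule, as a graded module. -/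
def sub {M : GrModule A} (N : Submodule A M) (hN : IsGraded N) : GrModule A where
  carrier := N
  deg i := (M.deg i).comap (N.subtype.restrictScalars K)
  isCompl := by
    constructor
    · rw [Submodule.disjoint_def]
      intro x h0 h1
      exact Subtype.ext (Submodule.disjoint_def.1 M.isCompl.disjoint x.1 h0 h1)
    · rw [Submodule.codisjoint_iff_exists_add_eq]
      intro x
      exact ⟨⟨_, isGraded_iff.1 hN 0 x.1 x.2⟩, ⟨_, isGraded_iff.1 hN 1 x.1 x.2⟩,
        M.proj_mem 0 x.1, M.proj_mem 1 x.1, Subtype.ext (M.proj_add_proj x.1)⟩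
  smul_mem := fun ha hm => M.smul_mem ha hm

/-- The inclusion of a graded submodule. -/
def subι {M : GrModule A} (N : Submodule A M) (hN : IsGraded N) : Hom (sub N hN) M where
  toLinearMap := N.subtype
  map_deg _ _ h := h

/-- The quotient by a graded submodule. -/
def quotient {M : GrModule A} (N : Submodule A M) (hN : IsGraded N) : GrModule A where
  carrier := M ⧸ N
  deg i := (M.deg i).map (N.mkQ.restrictScalars K)
  isCompl := by
    constructor
    · rw [Submodule.disjoint_def]
      rintro _ ⟨x, hx, rfl⟩ ⟨y, hy, hxy⟩
      have h : y - x ∈ N := (Submodule.Quotient.eq N).1 hxy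
      have h' : x + -y ∈ N := by
        have := neg_mem h
        rwa [neg_sub, sub_eq_add_neg] at this
      exact (Submodule.Quotient.mk_eq_zero N).2 (hN x hx (-y) (neg_mem hy) h').1
    · rw [Submodule.codisjoint_iff_exists_add_eq]
      intro x
      obtain ⟨m, rfl⟩ := N.mkQ_surjective x
      exact ⟨_, _, ⟨_, M.proj_mem 0 m, rfl⟩, ⟨_, M.proj_mem 1 m, rfl⟩, by
        change N.mkQ _ + N.mkQ _ = _
        rw [← map_add, M.proj_add_proj]⟩
  smul_mem := by
    rintro i j a _ ha ⟨m, hm, rfl⟩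
    exact ⟨a • m, M.smul_mem ha hm, map_smul N.mkQ a m⟩

/-- The projection to the quotient by a graded submodule. -/
def quotientπ {M : GrModule A} (N : Submodule A M) (hN : IsGraded N) :
    Hom M (quotient N hN) where
  toLinearMap := N.mkQ
  map_deg _ m h := ⟨m, h, rfl⟩

theorem isExtension_sub_quotient {M : GrModule A} (N : Submodule A M) (hN : IsGraded N) :
    IsExtension (sub N hN) M (quotient N hN) :=
  ⟨subι N hN, quotientπ N hN, N.injective_subtype, N.mkQ_surjective,
    LinearMap.exact_subtype_mkQ N⟩

/-! ### Isomorphisms and monomorphisms in `Gr A` -/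

theorem isIso_of_bijective {M N : GrModule A} (f : M ⟶ N)
    (hf : Function.Bijective (Hom.toLinearMap f)) : IsIso f := by
  let e := LinearEquiv.ofBijective (Hom.toLinearMap f) hf
  let g : Hom N M :=
    { toLinearMap := e.symm.toLinearMap
      map_deg := by
        intro i n hn
        rw [M.mem_deg_iff]
        apply hf.1
        rw [Hom.map_proj]
        have : Hom.toLinearMap f (e.symm n) = n := e.apply_symm_apply n
        change N.proj i (Hom.toLinearMap f (e.symm n)) = Hom.toLinearMap f (e.symm n)
        rw [this, N.proj_of_mem hn] }
  exact ⟨g, Hom.ext (LinearMap.ext fun m => e.symm_apply_apply m),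
    Hom.ext (LinearMap.ext fun n => e.apply_symm_apply n)⟩

theorem nonempty_iso_of_bijective {M N : GrModule A} (f : Hom M N)
    (hf : Function.Bijective f.toLinearMap) : Nonempty (M ≅ N) :=
  have := isIso_of_bijective (M := M) (N := N) f hf
  ⟨asIso (X := M) (Y := N) f⟩

theorem bijective_of_isIso {M N : GrModule A} (f : M ⟶ N) [IsIso f] :
    Function.Bijective (Hom.toLinearMap f) := by
  have h1 : ∀ m, Hom.toLinearMap (inv f) (Hom.toLinearMap f m) = m := fun m =>
    LinearMap.congr_fun (congrArg Hom.toLinearMap (IsIso.hom_inv_id f)) m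
  have h2 : ∀ m, Hom.toLinearMap f (Hom.toLinearMap (inv f) m) = m := fun m =>
    LinearMap.congr_fun (congrArg Hom.toLinearMap (IsIso.inv_hom_id f)) m
  exact ⟨Function.LeftInverse.injective h1, Function.RightInverse.surjective h2⟩

/-- The zero morphism. -/
def zeroHom (M N : GrModule A) : Hom M N where
  toLinearMap := 0
  map_deg i _ _ := zero_mem (N.deg i)

/-- A monomorphism cannot tell the inclusion of its kernel from the zero map. -/
theorem injective_of_mono {M N : GrModule A} (f : M ⟶ N) [Mono f] :
    Function.Injective (Hom.toLinearMap f) := by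
  let k : sub _ (Hom.isGraded_ker f) ⟶ M := subι _ (Hom.isGraded_ker f)
  let z : sub _ (Hom.isGraded_ker f) ⟶ M := zeroHom _ _
  have hk : k ≫ f = z ≫ f := Hom.ext <| LinearMap.ext fun x =>
    (show Hom.toLinearMap f x.1 = Hom.toLinearMap f 0 by
      rw [LinearMap.mem_ker.1 x.2, map_zero])
  have hkz : k = z := (cancel_mono f).1 hk
  rw [← LinearMap.ker_eq_bot, Submodule.eq_bot_iff]
  intro x hx
  exact LinearMap.congr_fun (congrArg Hom.toLinearMap hkz) ⟨x, hx⟩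

theorem mono_of_injective {M N : GrModule A} (f : M ⟶ N)
    (hf : Function.Injective (Hom.toLinearMap f)) : Mono f :=
  ⟨fun _ _ hgh => Hom.ext <| LinearMap.ext fun x =>
    hf (LinearMap.congr_fun (congrArg Hom.toLinearMap hgh) x)⟩

end GrModule

/-! ### Irreducibility is a categorical property -/

/-- An object into which there are two different morphisms, and all of whose subobjects are
either isomorphisms or admit at most one morphism from any object. In a category with zero
morphisms this says that the object is simple; the formulation without zero morphisms makes the
invariance under equivalences immediate. -/
def IsCatSimple {C : Type*} [Category C] (X : C) : Prop :=
  (∃ (Z : C) (g h : Z ⟶ X), g ≠ h) ∧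
    ∀ (Y : C) (f : Y ⟶ X), Mono f → (∀ (Z : C) (g h : Z ⟶ Y), g = h) ∨ IsIso f

theorem IsCatSimple.of_iso {C : Type*} [Category C] {X Y : C} (h : IsCatSimple X) (e : X ≅ Y) :
    IsCatSimple Y := by
  obtain ⟨⟨Z, g, g', hne⟩, h2⟩ := h
  refine ⟨⟨Z, g ≫ e.hom, g' ≫ e.hom, fun h => hne ((cancel_mono e.hom).1 h)⟩, fun W f hf => ?_⟩
  obtain hs | hi := h2 W (f ≫ e.inv) inferInstance
  · exact Or.inl hs
  · exact Or.inr (IsIso.of_isIso_comp_right f e.inv)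

theorem IsCatSimple.map {C D : Type*} [Category C] [Category D] (F : C ≌ D) {X : C}
    (h : IsCatSimple X) : IsCatSimple (F.functor.obj X) := by
  obtain ⟨⟨Z, g, g', hne⟩, h2⟩ := h
  refine ⟨⟨_, F.functor.map g, F.functor.map g', fun h => hne (F.functor.map_injective h)⟩,
    fun W f hf => ?_⟩
  obtain hs | hi := h2 _ (F.inverse.map f ≫ F.unitInv.app X) inferInstance
  · exact Or.inl fun Z _ _ => F.inverse.map_injective (hs _ _ _)
  · have := IsIso.of_isIso_comp_right (F.inverse.map f) (F.unitInv.app X)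
    exact Or.inr (isIso_of_reflects_iso f F.inverse)

theorem isCatSimple_map_iff {C D : Type*} [Category C] [Category D] (F : C ≌ D) {X : C} :
    IsCatSimple (F.functor.obj X) ↔ IsCatSimple X :=
  ⟨fun h => (h.map F.symm).of_iso (F.unitIso.app X).symm, IsCatSimple.map F⟩

namespace GrModule

variable {K : Type} [Field K] {A B : Superalgebra K}

theorem isCatSimple_iff {M : GrModule A} : IsCatSimple M ↔ M.IsIrreducible := by
  constructor
  · rintro ⟨⟨Z, g, h, hne⟩, h2⟩
    refine ⟨?_, fun N hN => ?_⟩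
    · by_contra hM
      rw [not_nontrivial_iff_subsingleton] at hM
      exact hne (Hom.ext (LinearMap.ext fun x => Subsingleton.elim _ _))
    · have hm : Mono (X := sub N hN) (Y := M) (subι N hN) :=
        mono_of_injective (M := sub N hN) (N := M) (subι N hN) N.injective_subtype
      obtain h | h := h2 (sub N hN) (subι N hN) hm
      · left
        rw [Submodule.eq_bot_iff]
        intro x hx
        have := LinearMap.congr_fun (congrArg Hom.toLinearMap
          (h (sub N hN) (𝟙 _) (zeroHom _ _))) ⟨x, hx⟩
        exact congrArg Subtype.val this
      · right
        rw [Submodule.eq_top_iff']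
        intro x
        obtain ⟨y, rfl⟩ := (bijective_of_isIso (M := sub N hN) (N := M) (subι N hN)).2 x
        exact y.2
  · rintro ⟨hM, h2⟩
    refine ⟨⟨M, 𝟙 M, zeroHom M M, fun h => ?_⟩, fun N f hf => ?_⟩
    · obtain ⟨x, hx⟩ := exists_ne (0 : M)
      exact hx (LinearMap.congr_fun (congrArg Hom.toLinearMap h) x)
    · have hinj := injective_of_mono f
      obtain h | h := h2 _ (Hom.isGraded_range f)
      · left
        intro Z g h'
        refine Hom.ext (LinearMap.ext fun x => hinj ?_)
        rw [LinearMap.range_eq_bot] at h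
        rw [h]
        rfl
      · exact Or.inr (isIso_of_bijective f ⟨hinj, LinearMap.range_eq_top.1 h⟩)

theorem isIrreducible_map_iff (F : GrModule A ≌ GrModule B) {M : GrModule A} :
    (F.functor.obj M).IsIrreducible ↔ M.IsIrreducible := by
  rw [← isCatSimple_iff, ← isCatSimple_iff, isCatSimple_map_iff]

theorem IsIrreducible.of_iso {M N : GrModule A} (h : M.IsIrreducible) (e : M ≅ N) :
    N.IsIrreducible :=
  isCatSimple_iff.1 ((isCatSimple_iff.2 h).of_iso e)

theorem IsIrreducible.suspension {M : GrModule A} (h : M.IsIrreducible) :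
    M.suspension.IsIrreducible :=
  ⟨h.1, fun N hN => h.2 N fun x hx y hy hxy =>
    (hN y hy x hx ((congrArg (· ∈ N) (add_comm (G := M) x y)).mp hxy)).symm⟩

end GrModule

/-! ### Full corners of superalgebras -/

theorem Superalgebra.eq_zero_of_mem {K : Type} [Field K] (A : Superalgebra K) {i : ZMod 2} {a : A}
    (h : a ∈ A.deg i) (h' : a ∈ A.deg (i + 1)) : a = 0 :=
  (GrModule.regular A).eq_zero_of_mem h h'

/-- An identification of the superalgebra `B` with a full corner `e A e` of `A`, where `e ∈ A₀` is
an idempotent with `A e A = A`: a multiplicative, not necessarily unital, even injection `B → A`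
that sends `1` to `e`, has image `e A e`, and such that `1` is a sum of products `a e b` with `a`
and `b` homogeneous of the same degree. -/
structure FullCorner {K : Type} [Field K] (B A : Superalgebra K) where
  toFun : B →ₗ[K] A
  injective : Function.Injective toFun
  map_mul : ∀ b c, toFun (b * c) = toFun b * toFun c
  map_deg : ∀ i, ∀ b ∈ B.deg i, toFun b ∈ A.deg i
  exists_eq : ∀ a : A, ∃ b, toFun b = toFun 1 * a * toFun 1
  full : (1 : A) ∈ Submodule.span K
    {x : A | ∃ i, ∃ a ∈ A.deg i, ∃ b ∈ A.deg i, x = a * toFun 1 * b}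

namespace FullCorner

variable {K : Type} [Field K] {A B C : Superalgebra K}

/-- An even injection reflects degrees. -/
theorem mem_deg_of_map_mem (f : B →ₗ[K] A) (hf : Function.Injective f)
    (hdeg : ∀ i, ∀ b ∈ B.deg i, f b ∈ A.deg i) {i : ZMod 2} {b : B} (h : f b ∈ A.deg i) :
    b ∈ B.deg i := by
  let R := GrModule.regular B
  have hb : R.proj i b + R.proj (i + 1) b = b := by
    obtain rfl | rfl := GrModule.zero_or_one i
    · exact R.proj_add_proj b
    · exact (add_comm _ _).trans (R.proj_add_proj b)
  have h0 : f (R.proj i b) ∈ A.deg i := hdeg i _ (R.proj_mem i b)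
  have h1 : f (R.proj (i + 1) b) ∈ A.deg (i + 1) := hdeg _ _ (R.proj_mem _ b)
  have h2 : f (R.proj (i + 1) b) ∈ A.deg i := by
    have : f (R.proj (i + 1) b) = f b - f (R.proj i b) := by
      rw [eq_sub_iff_add_eq']
      exact (map_add f _ _).symm.trans (congrArg f hb)
    rw [this]
    exact sub_mem h h0
  have h3 : R.proj (i + 1) b = 0 := hf ((A.eq_zero_of_mem h2 h1).trans (map_zero f).symm)
  rw [h3, add_zero] at hb
  exact hb ▸ R.proj_mem i b

/-- Isomorphic superalgebras are full corners of each other. -/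
def ofAlgEquiv (φ : B ≃ₐ[K] A) (h : ∀ i, ∀ b ∈ B.deg i, φ b ∈ A.deg i) : FullCorner B A where
  toFun := φ.toLinearMap
  injective := φ.injective
  map_mul := _root_.map_mul φ
  map_deg := h
  exists_eq a := ⟨φ.symm a, by simp⟩
  full := Submodule.subset_span ⟨0, 1, A.one_mem, 1, A.one_mem, by simp⟩

/-- A full corner of a full corner is a full corner. -/
def trans (c : FullCorner C B) (d : FullCorner B A) : FullCorner C A where
  toFun := d.toFun ∘ₗ c.toFun
  injective := d.injective.comp c.injective
  map_mul x y := by simp [c.map_mul, d.map_mul]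
  map_deg i x hx := d.map_deg i _ (c.map_deg i x hx)
  exists_eq a := by
    have h1 : d.toFun (c.toFun 1) = d.toFun 1 * d.toFun (c.toFun 1) := by
      rw [← d.map_mul, one_mul]
    have h2 : d.toFun (c.toFun 1) = d.toFun (c.toFun 1) * d.toFun 1 := by
      rw [← d.map_mul, mul_one]
    obtain ⟨b, hb⟩ := d.exists_eq a
    obtain ⟨x, hx⟩ := c.exists_eq b
    refine ⟨x, ?_⟩
    simp only [LinearMap.comp_apply]
    have h3 : ∀ y : A, d.toFun (c.toFun 1) * (d.toFun 1 * y) = d.toFun (c.toFun 1) * y :=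
      fun y => by rw [← mul_assoc, ← h2]
    rw [hx, d.map_mul, d.map_mul, hb]
    simp only [mul_assoc]
    rw [h3, ← h1]
  -- Substitute `1_B ∈ B e B` into `1_A ∈ A 1_B A`; the degrees of the two decompositions add up.
  full := by
    set S := Submodule.span K {x : A | ∃ i, ∃ a ∈ A.deg i, ∃ b ∈ A.deg i,
      x = a * (d.toFun ∘ₗ c.toFun) 1 * b}
    have key : ∀ y ∈ Submodule.span K {x : B | ∃ i, ∃ a ∈ B.deg i, ∃ b ∈ B.deg i,
        x = a * c.toFun 1 * b}, ∀ i, ∀ a ∈ A.deg i, ∀ b ∈ A.deg i, a * d.toFun y * b ∈ S := by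
      intro y hy
      induction hy using Submodule.span_induction with
      | mem y hy =>
        obtain ⟨j, s, hs, t, ht, rfl⟩ := hy
        intro i a ha b hb
        refine Submodule.subset_span ⟨i + j, a * d.toFun s, A.mul_mem ha (d.map_deg j s hs),
          d.toFun t * b, add_comm i j ▸ A.mul_mem (d.map_deg j t ht) hb, ?_⟩
        simp [d.map_mul, mul_assoc]
      | zero => intro i a _ b _; simp
      | add x y _ _ hx hy =>
        intro i a ha b hb
        rw [map_add, mul_add, add_mul]
        exact add_mem (hx i a ha b hb) (hy i a ha b hb)
      | smul k x _ hx =>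
        intro i a ha b hb
        rw [map_smul, mul_smul_comm, smul_mul_assoc]
        exact S.smul_mem k (hx i a ha b hb)
    refine Submodule.span_le.2 ?_ d.full
    rintro _ ⟨i, a, ha, b, hb, rfl⟩
    exact key 1 c.full i a ha b hb

variable (c : FullCorner B A)

/-- The idempotent of a corner. -/
def e : A := c.toFun 1

theorem e_mem : c.e ∈ A.deg 0 := c.map_deg 0 1 B.one_mem

@[simp]
theorem e_mul_toFun (b : B) : c.e * c.toFun b = c.toFun b := by
  rw [e, ← c.map_mul, one_mul]

@[simp]
theorem toFun_mul_e (b : B) : c.toFun b * c.e = c.toFun b := by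
  rw [e, ← c.map_mul, mul_one]

@[simp]
theorem e_mul_e : c.e * c.e = c.e := c.e_mul_toFun 1

/-- The map `A → B ≅ e A e` that sends `a` to `e a e`. -/
noncomputable def compress : A →ₗ[K] B where
  toFun a := (c.exists_eq a).choose
  map_add' x y := c.injective <| by
    rw [map_add, (c.exists_eq _).choose_spec, (c.exists_eq _).choose_spec,
      (c.exists_eq _).choose_spec, mul_add, add_mul]
  map_smul' k x := c.injective <| by
    rw [map_smul, (c.exists_eq _).choose_spec, RingHom.id_apply, (c.exists_eq _).choose_spec,
      mul_smul_comm, smul_mul_assoc]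

@[simp]
theorem toFun_compress (a : A) : c.toFun (c.compress a) = c.e * a * c.e :=
  (c.exists_eq a).choose_spec

theorem compress_one : c.compress 1 = 1 := c.injective <| by
  rw [toFun_compress, mul_one, e_mul_e, e]

theorem compress_mem {i : ZMod 2} {a : A} (h : a ∈ A.deg i) : c.compress a ∈ B.deg i := by
  refine mem_deg_of_map_mem c.toFun c.injective c.map_deg ?_
  rw [toFun_compress]
  simpa using A.mul_mem (A.mul_mem c.e_mem h) c.e_mem

theorem compress_mul_toFun (a : A) (b : B) : c.compress (a * c.toFun b) = c.compress a * b :=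
  c.injective <| by simp [c.map_mul, mul_assoc]

theorem compress_mul_e (a : A) : c.compress (a * c.e) = c.compress a :=
  (c.compress_mul_toFun a 1).trans (mul_one _)

theorem exists_sum : ∃ (n : ℕ) (d : Fin n → ZMod 2) (u v : Fin n → A),
    (∀ i, u i ∈ A.deg (d i)) ∧ (∀ i, v i ∈ A.deg (d i)) ∧ ∑ i, u i * c.e * v i = 1 := by
  obtain ⟨n, k, g, h⟩ := Submodule.mem_span_set'.1 c.full
  choose d u hu v hv hg using fun i => (g i).2
  refine ⟨n, d, fun i => k i • u i, v, fun i => (A.deg _).smul_mem _ (hu i), hv, ?_⟩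
  rw [← h]
  refine Finset.sum_congr rfl fun i _ => ?_
  rw [hg, smul_mul_assoc, smul_mul_assoc]
  rfl

/-- The number of summands in a chosen decomposition `1 = ∑ uᵢ e vᵢ`. -/
noncomputable def rank : ℕ := c.exists_sum.choose

/-- The degrees of `uᵢ` and `vᵢ` in a chosen decomposition `1 = ∑ uᵢ e vᵢ`. -/
noncomputable def d : Fin c.rank → ZMod 2 := c.exists_sum.choose_spec.choose

/-- The left factors of a chosen decomposition `1 = ∑ uᵢ e vᵢ`. -/
noncomputable def u : Fin c.rank → A := c.exists_sum.choose_spec.choose_spec.choose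

/-- The right factors of a chosen decomposition `1 = ∑ uᵢ e vᵢ`. -/
noncomputable def v : Fin c.rank → A := c.exists_sum.choose_spec.choose_spec.choose_spec.choose

theorem u_mem (i) : c.u i ∈ A.deg (c.d i) :=
  c.exists_sum.choose_spec.choose_spec.choose_spec.choose_spec.1 i

theorem v_mem (i) : c.v i ∈ A.deg (c.d i) :=
  c.exists_sum.choose_spec.choose_spec.choose_spec.choose_spec.2.1 i

theorem sum_u_e_v : ∑ i, c.u i * c.e * c.v i = 1 :=
  c.exists_sum.choose_spec.choose_spec.choose_spec.choose_spec.2.2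

/-- Inserting `1 = ∑ uᵢ e vᵢ` between two factors. -/
theorem sum_compress_mul (a b : A) :
    ∑ i, c.compress (a * c.u i) * c.compress (c.v i * b) = c.compress (a * b) := by
  apply c.injective
  rw [map_sum, toFun_compress]
  have h : c.e * (a * b) * c.e =
      ∑ i, c.e * (a * (c.u i * c.e * c.v i) * b) * c.e := by
    rw [← Finset.sum_mul, ← Finset.mul_sum, ← Finset.sum_mul, ← Finset.mul_sum, c.sum_u_e_v,
      mul_one]
  rw [h]
  refine Finset.sum_congr rfl fun i _ => ?_
  rw [c.map_mul, toFun_compress, toFun_compress]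
  simp only [mul_assoc]
  rw [← mul_assoc c.e c.e, e_mul_e]

/-! ### The module `e M` -/

variable (M N : GrModule A)

/-- The subspace `e M` of `M`. -/
def fixed : Submodule K M where
  carrier := {m | c.e • m = m}
  add_mem' {x y} hx hy := by
    simp only [Set.mem_ofPred_eq] at *
    rw [smul_add, hx, hy]
  zero_mem' := smul_zero _
  smul_mem' k x hx := by
    simp only [Set.mem_ofPred_eq] at *
    rw [smul_comm, hx]

theorem toFun_smul_mem (b : B) (m : M) : c.toFun b • m ∈ c.fixed M := by
  change c.e • c.toFun b • m = _
  rw [smul_smul, e_mul_toFun]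

theorem e_smul_mem (m : M) : c.e • m ∈ c.fixed M := c.toFun_smul_mem M 1 m

instance : Module B (c.fixed M) where
  smul b m := ⟨c.toFun b • m.1, c.toFun_smul_mem M b m.1⟩
  one_smul m := Subtype.ext m.2
  mul_smul b b' m := Subtype.ext (show c.toFun (b * b') • m.1 = c.toFun b • c.toFun b' • m.1 by
    rw [c.map_mul, mul_smul])
  smul_zero b := Subtype.ext (smul_zero (c.toFun b))
  smul_add b m m' := Subtype.ext (smul_add (c.toFun b) m.1 m'.1)
  add_smul b b' m := Subtype.ext
    (show c.toFun (b + b') • m.1 = c.toFun b • m.1 + c.toFun b' • m.1 by rw [map_add, add_smul])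
  zero_smul m := Subtype.ext (show c.toFun 0 • m.1 = 0 by rw [map_zero, zero_smul])

instance : IsScalarTower K B (c.fixed M) :=
  ⟨fun k b m => Subtype.ext (show c.toFun (k • b) • m.1 = k • c.toFun b • m.1 by
    rw [map_smul, smul_assoc])⟩

theorem proj_mem_fixed (i : ZMod 2) {m : M} (h : m ∈ c.fixed M) : M.proj i m ∈ c.fixed M := by
  have := M.proj_smul (i := i) c.e_mem m
  rw [zero_add, show c.e • m = m from h] at this
  exact this.symm

/-- The graded `B`-module `e M` attached to a graded `A`-module `M`. -/
def obj : GrModule B where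
  carrier := c.fixed M
  deg i := (M.deg i).comap (c.fixed M).subtype
  isCompl := by
    constructor
    · rw [Submodule.disjoint_def]
      intro x h0 h1
      exact Subtype.ext (Submodule.disjoint_def.1 M.isCompl.disjoint x.1 h0 h1)
    · rw [Submodule.codisjoint_iff_exists_add_eq]
      intro x
      exact ⟨⟨_, c.proj_mem_fixed M 0 x.2⟩, ⟨_, c.proj_mem_fixed M 1 x.2⟩,
        M.proj_mem 0 x.1, M.proj_mem 1 x.1, Subtype.ext (M.proj_add_proj x.1)⟩
  smul_mem := fun ha hm => M.smul_mem (c.map_deg _ _ ha) hm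

variable {M N}

/-- The restriction `e M → e N` of a morphism `M → N`. -/
def map (f : GrModule.Hom M N) : GrModule.Hom (c.obj M) (c.obj N) where
  toLinearMap :=
    { toFun := fun m => ⟨f.toLinearMap m.1, by
        change c.e • f.toLinearMap m.1 = _
        rw [← map_smul, show c.e • m.1 = m.1 from m.2]⟩
      map_add' := fun x y => Subtype.ext (map_add f.toLinearMap x.1 y.1)
      map_smul' := fun b x => Subtype.ext (map_smul f.toLinearMap (c.toFun b) x.1) }
  map_deg i m hm := f.map_deg i m.1 hm

/-- The functor `M ↦ e M` from graded `A`-modules to graded `B`-modules. -/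
def functor : GrModule A ⥤ GrModule B where
  obj M := c.obj M
  map f := c.map f

theorem sum_u_smul (m : M) : ∑ i, c.u i • c.e • c.v i • m = m := by
  simp only [smul_smul, ← mul_assoc]
  rw [← Finset.sum_smul, c.sum_u_e_v, one_smul]

instance : c.functor.Faithful where
  map_injective {M N} f g h := by
    refine GrModule.Hom.ext (LinearMap.ext fun m => ?_)
    have h' : ∀ x ∈ c.fixed M,
        GrModule.Hom.toLinearMap f x = GrModule.Hom.toLinearMap g x := fun x hx =>
      congrArg Subtype.val (LinearMap.congr_fun (congrArg GrModule.Hom.toLinearMap h) ⟨x, hx⟩)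
    rw [← c.sum_u_smul m, map_sum, map_sum]
    refine Finset.sum_congr rfl fun i _ => ?_
    rw [map_smul (GrModule.Hom.toLinearMap f), map_smul (GrModule.Hom.toLinearMap g),
      h' _ (c.e_smul_mem M _)]

/-- The map `M → e M`, `m ↦ e m`. -/
def cut (M : GrModule A) : M →+ c.obj M where
  toFun m := ⟨c.e • m, c.e_smul_mem M m⟩
  map_zero' := Subtype.ext (smul_zero _)
  map_add' x y := Subtype.ext (smul_add _ x y)

theorem coe_cut (m : M) : (c.cut M m).1 = c.e • m := rfl

theorem cut_mem {i : ZMod 2} {m : M} (h : m ∈ M.deg i) : c.cut M m ∈ (c.obj M).deg i := by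
  have := M.smul_mem c.e_mem h
  rwa [zero_add] at this

theorem coe_smul_obj (b : B) (m : c.obj M) : (b • m : c.obj M).1 = c.toFun b • m.1 := rfl

theorem e_smul_coe (m : c.obj M) : c.e • m.1 = m.1 := m.2

theorem coe_sum_obj {ι : Type*} (s : Finset ι) (f : ι → c.obj M) :
    (∑ i ∈ s, f i).1 = ∑ i ∈ s, (f i).1 :=
  map_sum (c.fixed M).subtype f s

theorem cut_smul (a : A) (m : M) :
    c.cut M (a • m) = ∑ j, c.compress (a * c.u j) • c.cut M (c.v j • m) := by
  apply Subtype.ext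
  rw [coe_sum_obj]
  simp only [coe_smul_obj, coe_cut, toFun_compress]
  conv_lhs => rw [← c.sum_u_smul m, Finset.smul_sum, Finset.smul_sum]
  refine Finset.sum_congr rfl fun j _ => ?_
  simp only [smul_smul, mul_assoc]
  rw [← mul_assoc c.e c.e, e_mul_e]

theorem cut_smul_coe (a : A) (m : c.obj M) : c.cut M (a • m.1) = c.compress a • m := by
  apply Subtype.ext
  rw [coe_smul_obj, coe_cut, toFun_compress, mul_smul, mul_smul, e_smul_coe]

/-- The extension of a morphism `g : e M → e N` to a morphism `M → N`, forced to be
`m ↦ ∑ uᵢ g(e vᵢ m)` by `m = ∑ uᵢ e vᵢ m`. -/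
noncomputable def extend (g : GrModule.Hom (c.obj M) (c.obj N)) : GrModule.Hom M N where
  toLinearMap :=
    { toFun := fun m => ∑ i, c.u i • (g.toLinearMap (c.cut M (c.v i • m))).1
      map_add' := fun x y => by
        rw [← Finset.sum_add_distrib]
        refine Finset.sum_congr rfl fun i _ => ?_
        rw [smul_add, map_add, map_add, ← smul_add]
        rfl
      map_smul' := fun a m => by
        have h : ∀ i, c.u i • (g.toLinearMap (c.cut M (c.v i • a • m))).1 =
            ∑ j, (c.u i * c.e * c.v i) • (a * c.u j) •
              (g.toLinearMap (c.cut M (c.v j • m))).1 := by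
          intro i
          rw [smul_smul (c.v i), c.cut_smul, map_sum, coe_sum_obj, Finset.smul_sum]
          refine Finset.sum_congr rfl fun j _ => ?_
          rw [map_smul, coe_smul_obj, toFun_compress, mul_smul _ c.e, e_smul_coe]
          simp only [smul_smul, mul_assoc]
        simp only [h]
        rw [Finset.sum_comm]
        simp only [← Finset.sum_smul, ← Finset.sum_mul, c.sum_u_e_v, one_mul, RingHom.id_apply,
          Finset.smul_sum, smul_smul] }
  map_deg k m hm := by
    change ∑ i, c.u i • (g.toLinearMap (c.cut M (c.v i • m))).1 ∈ N.deg k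
    refine sum_mem fun i _ => ?_
    have h1 := g.map_deg _ _ (c.cut_mem (M.smul_mem (c.v_mem i) hm))
    have h2 := N.smul_mem (c.u_mem i) (show (g.toLinearMap (c.cut M (c.v i • m))).1 ∈ N.deg _
      from h1)
    rwa [← add_assoc, CharTwo.add_self_eq_zero, zero_add] at h2

theorem extend_apply (g : GrModule.Hom (c.obj M) (c.obj N)) (m : c.obj M) :
    (c.extend g).toLinearMap m.1 = (g.toLinearMap m).1 := by
  change ∑ i, c.u i • (g.toLinearMap (c.cut M (c.v i • m.1))).1 = _
  simp only [cut_smul_coe, map_smul, coe_smul_obj, toFun_compress]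
  simp only [mul_smul, e_smul_coe]
  exact c.sum_u_smul _

instance : c.functor.Full where
  map_surjective g := ⟨c.extend g, GrModule.Hom.ext (LinearMap.ext fun m =>
    Subtype.ext (c.extend_apply g m))⟩

end FullCorner

/-! ### Modules induced from a full corner -/

namespace FullCorner

variable {K : Type} [Field K] {A B : Superalgebra K} (c : FullCorner B A) (N : GrModule B)

/-- The (non-unital) action of `A` on `Nⁿ`, through the matrices `(vᵢ a uⱼ)ᵢⱼ` compressed to
`B`. -/
noncomputable def act : A →ₗ[K] (Fin c.rank → N) →ₗ[K] (Fin c.rank → N) :=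
  LinearMap.mk₂ K (fun a x i => ∑ j, c.compress (c.v i * a * c.u j) • x j)
    (fun a b x => funext fun i => by
      simp only [mul_add, add_mul, map_add, add_smul, Finset.sum_add_distrib, Pi.add_apply])
    (fun k a x => funext fun i => by
      simp only [mul_smul_comm, smul_mul_assoc, map_smul, smul_assoc, Pi.smul_apply,
        Finset.smul_sum])
    (fun a x y => funext fun i => by
      simp only [Pi.add_apply, smul_add, Finset.sum_add_distrib])
    (fun k a x => funext fun i => by
      simp only [Pi.smul_apply, Finset.smul_sum]
      exact Finset.sum_congr rfl fun j _ => smul_comm _ _ _)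

theorem act_apply (a : A) (x : Fin c.rank → N) (i) :
    c.act N a x i = ∑ j, c.compress (c.v i * a * c.u j) • x j := rfl

theorem act_compress (a b : A) (n : N) :
    c.act N a (fun j => c.compress (c.v j * b) • n) = fun i => c.compress (c.v i * a * b) • n := by
  funext i
  rw [act_apply]
  simp only [smul_smul]
  rw [← Finset.sum_smul, c.sum_compress_mul]

theorem act_mul (a b : A) (x : Fin c.rank → N) : c.act N (a * b) x = c.act N a (c.act N b x) := by
  funext i
  simp only [act_apply, Finset.smul_sum]
  rw [Finset.sum_comm]
  refine Finset.sum_congr rfl fun j _ => ?_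
  simp only [smul_smul]
  rw [← Finset.sum_smul]
  simp only [mul_assoc (c.v _) b]
  rw [c.sum_compress_mul]
  simp only [mul_assoc]

/-- The image of the idempotent action of `1 ∈ A` on `Nⁿ`. -/
noncomputable def inducedSubmodule : Submodule K (Fin c.rank → N) :=
  LinearMap.eqLocus (c.act N 1) LinearMap.id

theorem mem_inducedSubmodule {x : Fin c.rank → N} :
    x ∈ c.inducedSubmodule N ↔ c.act N 1 x = x := Iff.rfl

theorem act_mem (a : A) (x : Fin c.rank → N) : c.act N a x ∈ c.inducedSubmodule N := by
  rw [mem_inducedSubmodule, ← act_mul, one_mul]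

noncomputable instance : Module A (c.inducedSubmodule N) where
  smul a x := ⟨c.act N a x.1, c.act_mem N a x.1⟩
  one_smul x := Subtype.ext x.2
  mul_smul a b x := Subtype.ext (c.act_mul N a b x.1)
  smul_zero a := Subtype.ext (map_zero (c.act N a))
  smul_add a x y := Subtype.ext (map_add (c.act N a) x.1 y.1)
  add_smul a b x := Subtype.ext (by
    change c.act N (a + b) x.1 = c.act N a x.1 + c.act N b x.1
    rw [map_add, LinearMap.add_apply])
  zero_smul x := Subtype.ext (by
    change c.act N 0 x.1 = 0
    rw [map_zero, LinearMap.zero_apply])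

theorem coe_smul_induced (a : A) (x : c.inducedSubmodule N) : (a • x).1 = c.act N a x.1 := rfl

instance : IsScalarTower K A (c.inducedSubmodule N) :=
  ⟨fun k a x => Subtype.ext (by
    rw [coe_smul_induced, map_smul, LinearMap.smul_apply]
    rfl)⟩

theorem compress_mem_of_mem {a : A} {l : ZMod 2} (ha : a ∈ A.deg l) (i j : Fin c.rank) :
    c.compress (c.v i * a * c.u j) ∈ B.deg (c.d i + l + c.d j) :=
  c.compress_mem (A.mul_mem (A.mul_mem (c.v_mem i) ha) (c.u_mem j))

/-- The action of `A` on `Nⁿ` is compatible with the grading of the `i`-th coordinate shifted by the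
degree of `uᵢ`, because `vᵢ a uⱼ` has degree `dᵢ + |a| + dⱼ`. -/
theorem proj_act {a : A} {l : ZMod 2} (ha : a ∈ A.deg l) (k : ZMod 2) (x : Fin c.rank → N) :
    (fun i => N.proj (l + k + c.d i) (c.act N a x i)) =
      c.act N a (fun j => N.proj (k + c.d j) (x j)) := by
  funext i
  rw [act_apply, act_apply, map_sum]
  refine Finset.sum_congr rfl fun j _ => ?_
  rw [← N.proj_smul (c.compress_mem_of_mem ha i j)]
  congr 2
  have : ∀ p q r s : ZMod 2, q + r + p = p + q + s + (r + s) := by decide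
  exact this _ _ _ _

theorem proj_mem_induced (k : ZMod 2) {x : Fin c.rank → N} (h : x ∈ c.inducedSubmodule N) :
    (fun i => N.proj (k + c.d i) (x i)) ∈ c.inducedSubmodule N := by
  have := c.proj_act N A.one_mem k x
  rw [zero_add, (c.mem_inducedSubmodule N).1 h] at this
  rw [mem_inducedSubmodule, ← this]

/-- The graded `A`-module `A e ⊗_B N` induced from a graded `B`-module `N`, realised as the image
of an idempotent matrix acting on `Nⁿ`. The `i`-th coordinate is shifted by the degree of `uᵢ`. -/
noncomputable def induced : GrModule A where
  carrier := c.inducedSubmodule N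
  deg k := (Submodule.pi Set.univ fun i => N.deg (k + c.d i)).comap
    (c.inducedSubmodule N).subtype
  isCompl := by
    constructor
    · rw [Submodule.disjoint_def]
      intro x h0 h1
      refine Subtype.ext (funext fun i => N.eq_zero_of_mem (h0 i trivial) ?_)
      have h1' : x.1 i ∈ N.deg (1 + c.d i) := h1 i trivial
      rwa [add_comm 1, ← zero_add (c.d i)] at h1'
    · rw [Submodule.codisjoint_iff_exists_add_eq]
      intro x
      refine ⟨⟨_, c.proj_mem_induced N 0 x.2⟩, ⟨_, c.proj_mem_induced N 1 x.2⟩,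
        fun i _ => N.proj_mem _ _, fun i _ => N.proj_mem _ _, Subtype.ext (funext fun i => ?_)⟩
      change N.proj (0 + c.d i) (x.1 i) + N.proj (1 + c.d i) (x.1 i) = x.1 i
      obtain h | h := GrModule.zero_or_one (c.d i)
      · rw [h]
        exact N.proj_add_proj _
      · rw [h, add_comm]
        exact N.proj_add_proj _
  smul_mem := by
    intro l k a x ha hx i _
    change ∑ j, c.compress (c.v i * a * c.u j) • x.1 j ∈ N.deg (l + k + c.d i)
    refine sum_mem fun j _ => ?_
    have := N.smul_mem (c.compress_mem_of_mem ha i j) (hx j trivial)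
    have h : ∀ p q r s : ZMod 2, p + q + s + (r + s) = q + r + p := by decide
    rwa [h] at this

/-- The isomorphism `N ≅ e (A e ⊗_B N)`. -/
noncomputable def unitHom : GrModule.Hom N (c.obj (c.induced N)) where
  toLinearMap :=
    { toFun := fun n => ⟨⟨fun i => c.compress (c.v i * c.e) • n, by
          rw [mem_inducedSubmodule, act_compress]
          simp only [mul_one]⟩, Subtype.ext (by
          change c.act N c.e (fun i => c.compress (c.v i * c.e) • n) = _
          rw [act_compress]
          simp only [mul_assoc, e_mul_e])⟩
      map_add' := fun x y => Subtype.ext (Subtype.ext (funext fun i => smul_add _ x y))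
      map_smul' := fun b n => Subtype.ext (Subtype.ext (by
        change (fun i => c.compress (c.v i * c.e) • b • n) =
          c.act N (c.toFun b) (fun i => c.compress (c.v i * c.e) • n)
        rw [act_compress]
        funext i
        rw [compress_mul_e, compress_mul_e, compress_mul_toFun, mul_smul])) }
  map_deg k n hn i _ := by
    have := N.smul_mem (c.compress_mem (A.mul_mem (c.v_mem i) c.e_mem)) hn
    rwa [add_zero, add_comm] at this

theorem unitHom_bijective : Function.Bijective (c.unitHom N).toLinearMap := by
  have hsum : ∀ n : N, ∑ j, c.compress (c.u j) • c.compress (c.v j * c.e) • n = n := fun n => by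
    simp only [smul_smul]
    rw [← Finset.sum_smul]
    have := c.sum_compress_mul 1 c.e
    simp only [one_mul] at this
    rw [this, ← one_mul c.e, compress_mul_e, compress_one, one_smul]
  constructor
  · intro n n' h
    have h' : ∀ i, c.compress (c.v i * c.e) • n = c.compress (c.v i * c.e) • n' := fun i =>
      congrFun (congrArg (fun y : c.obj (c.induced N) => y.1.1) h) i
    rw [← hsum n, ← hsum n']
    simp only [h']
  · intro x
    have hx : c.act N c.e x.1.1 = x.1.1 := congrArg Subtype.val x.2
    refine ⟨∑ j, c.compress (c.u j) • x.1.1 j, Subtype.ext (Subtype.ext ?_)⟩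
    change (fun i => c.compress (c.v i * c.e) • ∑ j, c.compress (c.u j) • x.1.1 j) = x.1.1
    funext i
    conv_rhs => rw [← hx, act_apply]
    rw [Finset.smul_sum]
    refine Finset.sum_congr rfl fun j _ => ?_
    rw [smul_smul, compress_mul_e, ← compress_mul_toFun, toFun_compress, ← mul_assoc,
      compress_mul_e, mul_assoc]

instance : c.functor.EssSurj where
  mem_essImage N := ⟨c.induced N,
    (GrModule.nonempty_iso_of_bijective _ (c.unitHom_bijective N)).map Iso.symm⟩

instance : c.functor.IsEquivalence where

/-- The graded Morita equivalence `M ↦ e M`. -/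
noncomputable def equivalence : GrModule A ≌ GrModule B := c.functor.asEquivalence

/-! ### The progenerator `A e` -/

/-- The left ideal `A e`. -/
def leftIdeal : Submodule A A where
  carrier := {a : A | a * c.e = a}
  add_mem' {x y} hx hy := (add_mul x y c.e).trans (congrArg₂ (· + ·) hx hy)
  zero_mem' := zero_mul c.e
  smul_mem' a x hx := (mul_assoc a x c.e).trans (congrArg (a * ·) hx)

theorem mem_leftIdeal {a : A} : a ∈ c.leftIdeal ↔ a * c.e = a := Iff.rfl

theorem isGraded_leftIdeal : GrModule.IsGraded (M := GrModule.regular A) c.leftIdeal := by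
  intro (x : A) (hx : x ∈ A.deg 0) (y : A) (hy : y ∈ A.deg 1) (h : (x + y) * c.e = x + y)
  have hx' : x * c.e ∈ A.deg 0 := by simpa using A.mul_mem hx c.e_mem
  have hy' : y * c.e ∈ A.deg 1 := by simpa using A.mul_mem hy c.e_mem
  have h1 : x * c.e - x = y - y * c.e := by
    rw [add_mul] at h
    rw [sub_eq_sub_iff_add_eq_add, h, add_comm]
  have h2 : x * c.e - x = 0 := A.eq_zero_of_mem (i := 0) (sub_mem hx' hx) (by
    rw [h1]; exact sub_mem hy hy')
  exact ⟨sub_eq_zero.1 h2, (sub_eq_zero.1 (h1.symm.trans h2)).symm⟩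

/-- The graded module `A e`. -/
def progenerator : GrModule A :=
  GrModule.sub (M := GrModule.regular A) c.leftIdeal c.isGraded_leftIdeal

/-- The inclusion `A e → A`. -/
def ofProgenerator : c.progenerator →ₗ[A] A := c.leftIdeal.subtype

theorem progenerator_ext {x y : c.progenerator} (h : c.ofProgenerator x = c.ofProgenerator y) :
    x = y := Subtype.ext h

/-- The projection `A → A e`, `a ↦ a e`. -/
def toProgenerator : A →ₗ[A] c.progenerator where
  toFun a := ⟨a * c.e, c.mem_leftIdeal.2 (by rw [mul_assoc, e_mul_e])⟩
  map_add' x y := Subtype.ext (add_mul x y c.e)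
  map_smul' a x := Subtype.ext (mul_assoc a x c.e)

theorem toProgenerator_val (x : c.progenerator) :
    c.toProgenerator (c.ofProgenerator x) = x := Subtype.ext x.2

theorem finite_progenerator : Module.Finite A c.progenerator :=
  Module.Finite.of_surjective c.toProgenerator fun x => ⟨c.ofProgenerator x, c.toProgenerator_val x⟩

theorem projective_progenerator : Module.Projective A c.progenerator :=
  Module.Projective.of_split (M := A) c.ofProgenerator c.toProgenerator
    (LinearMap.ext fun x => c.toProgenerator_val x)

/-- Right multiplication by an element of `B ≅ e A e` on `A e`. -/
def rightMul (b : B) : Module.End A c.progenerator where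
  toFun x := ⟨c.ofProgenerator x * c.toFun b, c.mem_leftIdeal.2 (by rw [mul_assoc, toFun_mul_e])⟩
  map_add' x y := Subtype.ext (add_mul (c.ofProgenerator x) (c.ofProgenerator y) _)
  map_smul' a x := Subtype.ext (mul_assoc a (c.ofProgenerator x) _)

/-- The homomorphism `B → End(A e)` given by right multiplication. -/
def toTwistedEnd : B →ₐ[K] c.progenerator.twistedEnd :=
  AlgHom.ofLinearMap
    { toFun := fun b => MulOpposite.op (c.rightMul b)
      map_add' := fun b b' => MulOpposite.unop_injective <| LinearMap.ext fun x =>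
        c.progenerator_ext
        (show c.ofProgenerator x * c.toFun (b + b') = _ by rw [map_add, mul_add]; rfl)
      map_smul' := fun k b => MulOpposite.unop_injective <| LinearMap.ext fun x =>
        c.progenerator_ext
        (show c.ofProgenerator x * c.toFun (k • b) = _ by rw [map_smul, mul_smul_comm]; rfl) }
    (MulOpposite.unop_injective <| LinearMap.ext fun x => c.progenerator_ext x.2)
    (fun b b' => MulOpposite.unop_injective <| LinearMap.ext fun x =>
        c.progenerator_ext
      (show c.ofProgenerator x * c.toFun (b * b') = _ by rw [c.map_mul, ← mul_assoc]; rfl))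

/-- An endomorphism `f` of `A e` is right multiplication by `f(e) = e f(e) e`. -/
theorem toTwistedEnd_bijective : Function.Bijective c.toTwistedEnd := by
  let x₀ : c.progenerator := ⟨c.e, c.e_mul_e⟩
  constructor
  · intro b b' h
    have h1 : c.e * c.toFun b = c.e * c.toFun b' :=
      congrArg c.ofProgenerator (LinearMap.congr_fun (congrArg MulOpposite.unop h) x₀)
    simp only [e_mul_toFun] at h1
    exact c.injective h1
  · intro f
    let y : A := c.ofProgenerator (f.unop x₀)
    have hy : y * c.e = y := (f.unop x₀).2
    have hf : ∀ x : c.progenerator, c.ofProgenerator (f.unop x) = c.ofProgenerator x * y := by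
      intro x
      have hx : x = c.ofProgenerator x • x₀ := c.progenerator_ext x.2.symm
      conv_lhs => rw [hx, map_smul]
      rfl
    have hy' : c.e * y = y := (hf x₀).symm
    refine ⟨c.compress y, MulOpposite.unop_injective <| LinearMap.ext fun x =>
      c.progenerator_ext ?_⟩
    rw [hf]
    change c.ofProgenerator x * c.toFun (c.compress y) = _
    rw [toFun_compress, hy', hy]

include c in
theorem gradedMoritaEquivalent : GradedMoritaEquivalent A B :=
  ⟨⟨c.equivalence⟩, c.progenerator, c.finite_progenerator, c.projective_progenerator,
    AlgEquiv.ofBijective c.toTwistedEnd c.toTwistedEnd_bijective,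
    fun _ _ hb _ x hx => A.mul_mem (a := c.ofProgenerator x) hx (c.map_deg _ _ hb)⟩

/-! ### Exactness and finiteness of `M ↦ e M` -/

theorem isExtension {L M N : GrModule A} (h : GrModule.IsExtension L M N) :
    GrModule.IsExtension (c.obj L) (c.obj M) (c.obj N) := by
  obtain ⟨f, g, hf, hg, hfg⟩ := h
  refine ⟨c.map f, c.map g, fun x y hxy => ?_, fun y => ?_, fun y => ⟨fun hy => ?_, ?_⟩⟩
  · exact Subtype.ext (hf (congrArg Subtype.val hxy))
  · obtain ⟨x, hx⟩ := hg y.1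
    refine ⟨c.cut M x, Subtype.ext ?_⟩
    change g.toLinearMap (c.e • x) = _
    rw [map_smul, hx, e_smul_coe]
  · obtain ⟨x, hx⟩ := (hfg y.1).1 (congrArg Subtype.val hy)
    refine ⟨c.cut L x, Subtype.ext ?_⟩
    change f.toLinearMap (c.e • x) = _
    rw [map_smul, hx, e_smul_coe]
  · rintro ⟨x, rfl⟩
    exact Subtype.ext ((hfg _).2 ⟨x.1, rfl⟩)

theorem finiteDimensional_obj (M : GrModule A) [FiniteDimensional K M] :
    FiniteDimensional K (c.obj M) :=
  inferInstanceAs (FiniteDimensional K (c.fixed M))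

/-- `M` is spanned by finitely many images of `e M`, since `m = ∑ uᵢ e vᵢ m`. -/
theorem finiteDimensional_of_obj (M : GrModule A) [FiniteDimensional K (c.obj M)] :
    FiniteDimensional K M := by
  let f : (Fin c.rank → c.obj M) →ₗ[K] M :=
    { toFun := fun x => ∑ i, c.u i • (x i).1
      map_add' := fun x y => by
        rw [← Finset.sum_add_distrib]
        exact Finset.sum_congr rfl fun i _ => smul_add (c.u i) (x i).1 (y i).1
      map_smul' := fun k x => by
        rw [RingHom.id_apply, Finset.smul_sum]
        exact Finset.sum_congr rfl fun i _ => smul_comm (c.u i) k (x i).1 }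
  exact Module.Finite.of_surjective f fun m => ⟨fun i => c.cut M (c.v i • m), c.sum_u_smul m⟩

end FullCorner

/-! ### Graded division superalgebras and their irreducible modules -/

/-- A non-zero superalgebra all of whose non-zero homogeneous elements are invertible. -/
structure Superalgebra.IsGradedDivision {K : Type} [Field K] (B : Superalgebra K) : Prop where
  nontrivial : Nontrivial B
  exists_inv : ∀ i, ∀ b ∈ B.deg i, b ≠ 0 → ∃ b' : B, b' * b = 1

namespace GrModule

variable {K : Type} [Field K] {A B : Superalgebra K}

/-- Schur's lemma. -/
theorem Hom.bijective_of_isIrreducible {M N : GrModule A} (hM : M.IsIrreducible)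
    (hN : N.IsIrreducible) (f : Hom M N) (hf : f.toLinearMap ≠ 0) :
    Function.Bijective f.toLinearMap := by
  constructor
  · exact LinearMap.ker_eq_bot.1 <| (hM.2 _ f.isGraded_ker).resolve_right fun h =>
      hf (LinearMap.ker_eq_top.1 h)
  · exact LinearMap.range_eq_top.1 <| (hN.2 _ f.isGraded_range).resolve_left fun h =>
      hf (LinearMap.range_eq_bot.1 h)

/-- The morphism `A → M` sending `1` to a given even element. -/
def homOfEven (M : GrModule A) (m : M) (hm : m ∈ M.deg 0) : Hom (regular A) M where
  toLinearMap := LinearMap.toSpanSingleton A M m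
  map_deg i a ha := by
    have := M.smul_mem (a := a) ha hm
    rwa [add_zero] at this

/-- The morphism `σ(A) → M` sending `1` to a given odd element. -/
def homOfOdd (M : GrModule A) (m : M) (hm : m ∈ M.deg 1) : Hom (regular A).suspension M where
  toLinearMap := LinearMap.toSpanSingleton A M m
  map_deg i a ha := by
    have := M.smul_mem (a := a) ha hm
    rwa [add_assoc, CharTwo.add_self_eq_zero, add_zero] at this

theorem IsIrreducible.nonempty_iso_of_even {M : GrModule A} (hM : M.IsIrreducible)
    (hA : (regular A).IsIrreducible) {m : M} (hm : m ∈ M.deg 0) (h0 : m ≠ 0) :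
    Nonempty (M ≅ regular A) :=
  (nonempty_iso_of_bijective _ ((homOfEven M m hm).bijective_of_isIrreducible hA hM
    fun h => h0 <| (one_smul A m).symm.trans (LinearMap.congr_fun h (1 : A)))).map Iso.symm

theorem IsIrreducible.nonempty_iso_of_odd {M : GrModule A} (hM : M.IsIrreducible)
    (hA : (regular A).IsIrreducible) {m : M} (hm : m ∈ M.deg 1) (h0 : m ≠ 0) :
    Nonempty (M ≅ (regular A).suspension) :=
  (nonempty_iso_of_bijective _ ((homOfOdd M m hm).bijective_of_isIrreducible hA.suspension hM
    fun h => h0 <| (one_smul A m).symm.trans (LinearMap.congr_fun h (1 : A)))).map Iso.symm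

theorem isIrreducible_regular (hB : B.IsGradedDivision) : (regular B).IsIrreducible := by
  refine ⟨hB.nontrivial, fun N hN => or_iff_not_imp_left.2 fun h => ?_⟩
  obtain ⟨x, hx, hx0⟩ := (Submodule.ne_bot_iff N).1 h
  have hproj : ∀ i, (regular B).proj i x ≠ 0 → N = ⊤ := fun i hi => by
    obtain ⟨b, hb⟩ := hB.exists_inv i _ ((regular B).proj_mem i x) hi
    rw [Submodule.eq_top_iff']
    intro (y : B)
    have h1 : (1 : B) ∈ N := hb ▸ N.smul_mem b (isGraded_iff.1 hN i x hx)
    exact mul_one y ▸ N.smul_mem y h1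
  by_contra hne
  refine hx0 ?_
  rw [← (regular B).proj_add_proj x, not_not.1 fun h => hne (hproj 0 h),
    not_not.1 fun h => hne (hproj 1 h), add_zero]

theorem isIrreducible_iff (hB : B.IsGradedDivision) {M : GrModule B} :
    M.IsIrreducible ↔
      Nonempty (M ≅ regular B) ∨ Nonempty (M ≅ (regular B).suspension) := by
  have hreg := isIrreducible_regular hB
  constructor
  · intro hM
    have := hM.1
    obtain ⟨m, hm⟩ := exists_ne (0 : M)
    by_cases h0 : M.proj 0 m = 0
    · refine Or.inr (hM.nonempty_iso_of_odd hreg (M.proj_mem 1 m) fun h1 => hm ?_)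
      rw [← M.proj_add_proj m, h0, h1, add_zero]
    · exact Or.inl (hM.nonempty_iso_of_even hreg (M.proj_mem 0 m) h0)
  · rintro (⟨⟨e⟩⟩ | ⟨⟨e⟩⟩)
    exacts [hreg.of_iso e.symm, hreg.suspension.of_iso e.symm]

/-- Right multiplication by a non-zero odd element is an isomorphism `B ≅ σ(B)`; conversely the
image of `1` under such an isomorphism is a non-zero odd element. -/
theorem nonempty_regular_iso_suspension_iff (hB : B.IsGradedDivision) :
    Nonempty (regular B ≅ (regular B).suspension) ↔ B.deg 1 ≠ ⊥ := by
  have hreg := isIrreducible_regular hB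
  have := hB.nontrivial
  constructor
  · rintro ⟨e⟩ h
    have h1 := Hom.map_deg e.hom 0 (1 : B) B.one_mem
    have h2 : Hom.toLinearMap e.hom (1 : B) = 0 := by
      have h3 : Hom.toLinearMap e.hom (1 : B) ∈ B.deg 1 := h1
      rw [h] at h3
      exact (Submodule.mem_bot K).1 h3
    exact one_ne_zero (α := B) ((bijective_of_isIso e.hom).1 (h2.trans (map_zero _).symm))
  · intro h
    obtain ⟨u, hu, hu0⟩ := (Submodule.ne_bot_iff _).1 h
    exact (hreg.suspension.nonempty_iso_of_even hreg (m := u) hu hu0).map Iso.symm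

/-! ### Grothendieck groups -/

theorem GrothendieckGroup.mk_eq_add {L M N : FinDim A} (h : IsExtension L.1 M.1 N.1) :
    GrothendieckGroup.mk M = GrothendieckGroup.mk L + GrothendieckGroup.mk N :=
  (QuotientAddGroup.eq_iff_sub_mem (N := AddSubgroup.closure _)).2
    (AddSubgroup.subset_closure ⟨L, M, N, h, rfl⟩)

/-- For `M = 0` the sequence `0 → M → M → M → 0` is exact, so `[M] = [M] + [M]`. -/
theorem GrothendieckGroup.mk_eq_zero {M : FinDim A} [Subsingleton M.1] :
    GrothendieckGroup.mk M = 0 := by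
  have h : IsExtension M.1 M.1 M.1 := ⟨⟨LinearMap.id, fun _ _ h => h⟩,
    ⟨LinearMap.id, fun _ _ h => h⟩, fun _ _ h => h, fun x => ⟨x, rfl⟩,
    fun x => ⟨fun _ => ⟨x, rfl⟩, fun _ => Subsingleton.elim _ _⟩⟩
  exact left_eq_add.1 (GrothendieckGroup.mk_eq_add h)

theorem GrothendieckGroup.mk_eq_of_iso {M N : FinDim A} (e : M.1 ≅ N.1) :
    GrothendieckGroup.mk M = GrothendieckGroup.mk N := by
  have := M.2
  let Z : FinDim A := ⟨sub (⊥ : Submodule A M.1) (isGraded_bot M.1),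
    inferInstanceAs (FiniteDimensional K (⊥ : Submodule A M.1))⟩
  have : Subsingleton Z.1 := inferInstanceAs (Subsingleton (⊥ : Submodule A M.1))
  have hb := bijective_of_isIso e.hom
  have h : IsExtension Z.1 M.1 N.1 := ⟨subι _ (isGraded_bot M.1), e.hom,
    Subtype.val_injective, hb.2, fun x => ⟨fun hx => ⟨0, ?_⟩, ?_⟩⟩
  · rw [GrothendieckGroup.mk_eq_add h, GrothendieckGroup.mk_eq_zero (M := Z), zero_add]
  · exact (hb.1 (hx.trans (map_zero _).symm)).symm
  · rintro ⟨y, rfl⟩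
    rw [Subsingleton.elim y 0, map_zero, map_zero]

/-- A module that is neither zero nor irreducible is an extension of graded modules of smaller
dimension. -/
theorem GrothendieckGroup.mk_mem_closure (n : ℕ) :
    ∀ M : FinDim A, Module.finrank K M.1 ≤ n →
      GrothendieckGroup.mk M ∈ AddSubgroup.closure (irreducibleClasses A) := by
  induction n with
  | zero =>
    intro M hM
    have := M.2
    have := Module.finrank_zero_iff.1 (Nat.le_zero.1 hM)
    rw [GrothendieckGroup.mk_eq_zero]
    exact zero_mem _
  | succ n ih =>
    intro M hM
    have := M.2
    by_cases hi : M.1.IsIrreducible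
    · exact AddSubgroup.subset_closure ⟨M, hi, rfl⟩
    obtain hs | hnt := subsingleton_or_nontrivial M.1
    · rw [GrothendieckGroup.mk_eq_zero]
      exact zero_mem _
    obtain ⟨N, hN, hN0, hN1⟩ : ∃ N : Submodule A M.1, IsGraded N ∧ N ≠ ⊥ ∧ N ≠ ⊤ := by
      by_contra! h
      exact hi ⟨hnt, fun N hN => or_iff_not_imp_left.2 (h N hN)⟩
    let N' : Submodule K M.1 := N.restrictScalars K
    have hN0' : N' ≠ ⊥ := fun h => hN0 ((Submodule.restrictScalars_eq_bot_iff K A M.1).1 h)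
    have hN1' : N' ≠ ⊤ := fun h => hN1 ((Submodule.restrictScalars_eq_top_iff K A M.1).1 h)
    have hq := N'.finrank_quotient_add_finrank
    have hpos : 0 < Module.finrank K N' :=
      Nat.pos_of_ne_zero fun h => hN0' (Submodule.finrank_eq_zero.1 h)
    have hlt : Module.finrank K N' < Module.finrank K M.1 := Submodule.finrank_lt hN1'
    let L : FinDim A := ⟨sub N hN, inferInstanceAs (FiniteDimensional K N')⟩
    let Q : FinDim A := ⟨quotient N hN, inferInstanceAs (FiniteDimensional K (M.1 ⧸ N'))⟩
    have hL : Module.finrank K L.1 = Module.finrank K N' := rfl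
    have hQ : Module.finrank K Q.1 = Module.finrank K (M.1 ⧸ N') := rfl
    rw [GrothendieckGroup.mk_eq_add (L := L) (M := M) (N := Q) (isExtension_sub_quotient N hN)]
    exact add_mem (ih L (by omega)) (ih Q (by omega))

/-- Every finite dimensional graded module has a finite filtration with irreducible quotients, so
the Grothendieck group is generated by the classes of the irreducible modules. -/
theorem closure_irreducibleClasses :
    AddSubgroup.closure (irreducibleClasses A) = ⊤ := by
  rw [AddSubgroup.eq_top_iff']
  intro x
  obtain ⟨x, rfl⟩ := QuotientAddGroup.mk_surjective x
  induction x using FreeAbelianGroup.induction_on with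
  | zero => exact zero_mem _
  | of M => exact GrothendieckGroup.mk_mem_closure _ M le_rfl
  | neg M h => exact neg_mem h
  | add x y hx hy => exact add_mem hx hy

/-- An additive invariant of finite dimensional graded modules, as a homomorphism on the
Grothendieck group. -/
def GrothendieckGroup.lift {G : Type*} [AddCommGroup G] (χ : FinDim A → G)
    (h : ∀ L M N : FinDim A, IsExtension L.1 M.1 N.1 → χ M = χ L + χ N) :
    GrothendieckGroup A →+ G :=
  QuotientAddGroup.lift _ (FreeAbelianGroup.lift χ) (by
    rw [AddSubgroup.closure_le]
    rintro _ ⟨L, M, N, hext, rfl⟩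
    change FreeAbelianGroup.lift χ _ = 0
    rw [map_sub, map_add, FreeAbelianGroup.lift_apply_of, FreeAbelianGroup.lift_apply_of,
      FreeAbelianGroup.lift_apply_of, h L M N hext, sub_self])

theorem GrothendieckGroup.lift_mk {G : Type*} [AddCommGroup G] (χ : FinDim A → G)
    (h : ∀ L M N : FinDim A, IsExtension L.1 M.1 N.1 → χ M = χ L + χ N) (M : FinDim A) :
    GrothendieckGroup.lift χ h (GrothendieckGroup.mk M) = χ M :=
  FreeAbelianGroup.lift_apply_of _ _

theorem IsExtension.finrank_deg {L M N : GrModule A} (h : IsExtension L M N)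
    [FiniteDimensional K M] (i : ZMod 2) :
    Module.finrank K (M.deg i) = Module.finrank K (L.deg i) + Module.finrank K (N.deg i) := by
  obtain ⟨f, g, hf, hg, hfg⟩ := h
  let f' : L.deg i →ₗ[K] M.deg i := (f.toLinearMap.restrictScalars K).restrict (f.map_deg i)
  let g' : M.deg i →ₗ[K] N.deg i := (g.toLinearMap.restrictScalars K).restrict (g.map_deg i)
  have hf' : Function.Injective f' := fun x y hxy =>
    Subtype.ext (hf (congrArg Subtype.val hxy))
  have hg' : Function.Surjective g' := fun y => by
    obtain ⟨x, hx⟩ := hg y.1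
    refine ⟨⟨M.proj i x, M.proj_mem i x⟩, Subtype.ext ?_⟩
    change g.toLinearMap (M.proj i x) = y.1
    rw [g.map_proj, hx, N.proj_of_mem y.2]
  have hex : LinearMap.ker g' = LinearMap.range f' := by
    ext x
    rw [LinearMap.mem_ker, LinearMap.mem_range]
    constructor
    · intro hx
      obtain ⟨y, hy⟩ := (hfg x.1).1 (congrArg Subtype.val hx)
      refine ⟨⟨L.proj i y, L.proj_mem i y⟩, Subtype.ext ?_⟩
      change f.toLinearMap (L.proj i y) = x.1
      rw [f.map_proj, hy, M.proj_of_mem x.2]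
    · rintro ⟨y, rfl⟩
      exact Subtype.ext ((hfg _).2 ⟨y.1, rfl⟩)
  rw [← g'.finrank_range_add_finrank_ker, hex, LinearMap.finrank_range_of_inj hf',
    LinearMap.range_eq_top.2 hg', finrank_top, add_comm]

end GrModule

/-! ### Superalgebras with a graded division algebra as a full corner -/

namespace FullCorner

open GrModule

variable {K : Type} [Field K] {A B : Superalgebra K} (c : FullCorner B A)

/-- The homomorphism `[M] ↦ dim (e M)ᵢ` on the Grothendieck group. -/
noncomputable def dimHom (i : ZMod 2) : GrothendieckGroup A →+ ℤ :=
  GrothendieckGroup.lift (fun M => (Module.finrank K ((c.obj M.1).deg i) : ℤ)) fun L M N h => by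
    have := M.2
    have := c.finiteDimensional_obj M.1
    rw [(c.isExtension h).finrank_deg i]
    push_cast
    rfl

theorem dimHom_mk (i : ZMod 2) (M : FinDim A) :
    c.dimHom i (GrothendieckGroup.mk M) = Module.finrank K ((c.obj M.1).deg i) :=
  GrothendieckGroup.lift_mk _ _ _

/-- The irreducible `A`-module with `e M ≅ B`. -/
noncomputable def irrEven : GrModule A := c.induced (regular B)

/-- The irreducible `A`-module with `e M ≅ σ(B)`. -/
noncomputable def irrOdd : GrModule A := c.induced (regular B).suspension

theorem nonempty_obj_induced_iso (N : GrModule B) : Nonempty (c.obj (c.induced N) ≅ N) :=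
  (nonempty_iso_of_bijective _ (c.unitHom_bijective N)).map Iso.symm

theorem isIrreducible_obj_iff {M : GrModule A} : (c.obj M).IsIrreducible ↔ M.IsIrreducible :=
  isIrreducible_map_iff c.equivalence

theorem isIrreducible_induced {N : GrModule B} (h : N.IsIrreducible) :
    (c.induced N).IsIrreducible := by
  obtain ⟨e⟩ := c.nonempty_obj_induced_iso N
  exact c.isIrreducible_obj_iff.1 (h.of_iso e.symm)

theorem finiteDimensional_induced (N : GrModule B) [FiniteDimensional K N] :
    FiniteDimensional K (c.induced N) := by
  have hb := c.unitHom_bijective N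
  have : FiniteDimensional K (c.obj (c.induced N)) :=
    Module.Finite.of_surjective ((c.unitHom N).toLinearMap.restrictScalars K) hb.2
  exact c.finiteDimensional_of_obj _

theorem nonempty_iso_induced_iff {M : GrModule A} {N : GrModule B} :
    Nonempty (M ≅ c.induced N) ↔ Nonempty (c.obj M ≅ N) := by
  obtain ⟨e⟩ := c.nonempty_obj_induced_iso N
  constructor
  · rintro ⟨f⟩
    exact ⟨c.functor.mapIso f ≪≫ e⟩
  · rintro ⟨f⟩
    exact ⟨c.functor.preimageIso (f ≪≫ e.symm)⟩

theorem finrank_deg_eq_of_iso {M N : GrModule A} (e : M ≅ N) (i : ZMod 2) :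
    Module.finrank K (M.deg i) = Module.finrank K (N.deg i) := by
  have h1 : ∀ m, Hom.toLinearMap e.inv (Hom.toLinearMap e.hom m) = m := fun m =>
    LinearMap.congr_fun (congrArg Hom.toLinearMap e.hom_inv_id) m
  have h2 : ∀ m, Hom.toLinearMap e.hom (Hom.toLinearMap e.inv m) = m := fun m =>
    LinearMap.congr_fun (congrArg Hom.toLinearMap e.inv_hom_id) m
  exact LinearEquiv.finrank_eq (LinearEquiv.ofLinearMap
    (((Hom.toLinearMap e.hom).restrictScalars K).restrict (Hom.map_deg e.hom i))
    (((Hom.toLinearMap e.inv).restrictScalars K).restrict (Hom.map_deg e.inv i))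
    (LinearMap.ext fun x => Subtype.ext (h2 x.1)) (LinearMap.ext fun x => Subtype.ext (h1 x.1)))

theorem dimHom_induced (i : ZMod 2) (N : GrModule B) (h : FiniteDimensional K (c.induced N)) :
    c.dimHom i (GrothendieckGroup.mk ⟨c.induced N, h⟩) = Module.finrank K (N.deg i) := by
  obtain ⟨e⟩ := c.nonempty_obj_induced_iso N
  rw [dimHom_mk, finrank_deg_eq_of_iso e]

theorem isIrreducible_iff (hB : B.IsGradedDivision) {M : GrModule A} :
    M.IsIrreducible ↔ Nonempty (M ≅ c.irrEven) ∨ Nonempty (M ≅ c.irrOdd) := by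
  rw [← c.isIrreducible_obj_iff, GrModule.isIrreducible_iff hB, irrEven, irrOdd,
    nonempty_iso_induced_iff, nonempty_iso_induced_iff]

theorem finrank_deg_zero_pos (hB : B.IsGradedDivision) [FiniteDimensional K B] :
    0 < Module.finrank K (B.deg 0) := by
  have := hB.nontrivial
  have : Nontrivial (B.deg 0) :=
    ⟨⟨⟨1, B.one_mem⟩, 0, fun h => one_ne_zero (congrArg Subtype.val h)⟩⟩
  exact Module.finrank_pos

include c in
theorem oneIrreducible (hB : B.IsGradedDivision) [FiniteDimensional K B] (h1 : B.deg 1 ≠ ⊥) :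
    OneIrreducible A B := by
  obtain ⟨eσ⟩ := (nonempty_regular_iso_suspension_iff hB).2 h1
  have hirr : ∀ {M : GrModule A}, M.IsIrreducible ↔ Nonempty (M ≅ c.irrEven) := fun {M} => by
    rw [c.isIrreducible_iff hB, irrEven, irrOdd, nonempty_iso_induced_iff,
      nonempty_iso_induced_iff, or_iff_left_of_imp]
    exact fun ⟨f⟩ => ⟨f ≪≫ eσ.symm⟩
  have hS := c.isIrreducible_induced (isIrreducible_regular hB)
  have : FiniteDimensional K (regular B) := inferInstanceAs (FiniteDimensional K B)
  let S : FinDim A := ⟨c.irrEven, c.finiteDimensional_induced _⟩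
  refine ⟨c.gradedMoritaEquivalent, fun F M => ?_, ?_, ?_⟩
  · rw [← isIrreducible_map_iff F, GrModule.isIrreducible_iff hB, or_iff_left_of_imp]
    · simp
    · exact fun ⟨f⟩ => ⟨f ≪≫ eσ.symm⟩
  · rw [Nat.card_eq_one_iff_unique]
    refine ⟨⟨fun x y => ?_⟩, ⟨Quot.mk _ ⟨c.irrEven, hS⟩⟩⟩
    induction x using Quot.ind with
    | mk M =>
      induction y using Quot.ind with
      | mk N =>
        obtain ⟨f⟩ := hirr.1 M.2
        obtain ⟨g⟩ := hirr.1 N.2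
        exact Quot.sound ⟨f ≪≫ g.symm⟩
  · have hcls : irreducibleClasses A = {GrothendieckGroup.mk S} := by
      ext x
      rw [Set.mem_singleton_iff]
      constructor
      · rintro ⟨M, hM, rfl⟩
        obtain ⟨f⟩ := hirr.1 hM
        exact GrothendieckGroup.mk_eq_of_iso f
      · rintro rfl
        exact ⟨S, hS, rfl⟩
    -- `n ↦ n [S]` is injective because `dim (e S)₀ = dim B₀` is positive.
    let φ : ℤ →+ GrothendieckGroup A := zmultiplesHom _ (GrothendieckGroup.mk S)
    have hφ1 : φ 1 = GrothendieckGroup.mk S := by simp [φ]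
    have hinj : Function.Injective φ := by
      rw [injective_iff_map_eq_zero]
      intro n hn
      have h := congrArg (c.dimHom 0) hn
      have hpos := finrank_deg_zero_pos hB
      have hdim : c.dimHom 0 (GrothendieckGroup.mk S) = Module.finrank K (B.deg 0) :=
        c.dimHom_induced 0 (regular B) _
      simp only [φ, zmultiplesHom_apply, map_zsmul, map_zero, hdim, smul_eq_mul,
        mul_eq_zero] at h
      omega
    have hsurj : Function.Surjective φ := by
      rw [← AddMonoidHom.range_eq_top, eq_top_iff, ← closure_irreducibleClasses,
        AddSubgroup.closure_le, hcls, Set.singleton_subset_iff]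
      exact ⟨1, hφ1⟩
    refine ⟨(AddEquiv.ofBijective φ ⟨hinj, hsurj⟩).symm, ?_⟩
    rw [hcls, Set.image_singleton, Set.singleton_eq_singleton_iff, AddEquiv.symm_apply_eq]
    exact hφ1.symm

include c in
theorem twoIrreducibles (hB : B.IsGradedDivision) [FiniteDimensional K B] (h1 : B.deg 1 = ⊥) :
    TwoIrreducibles A B := by
  have hne : ¬ Nonempty (regular B ≅ (regular B).suspension) := fun h =>
    (nonempty_regular_iso_suspension_iff hB).1 h h1
  have hreg := isIrreducible_regular hB
  have hS := c.isIrreducible_induced hreg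
  have hT := c.isIrreducible_induced hreg.suspension
  have : FiniteDimensional K (regular B) := inferInstanceAs (FiniteDimensional K B)
  have : FiniteDimensional K (regular B).suspension := inferInstanceAs (FiniteDimensional K B)
  let S : FinDim A := ⟨c.irrEven, c.finiteDimensional_induced _⟩
  let T : FinDim A := ⟨c.irrOdd, c.finiteDimensional_induced _⟩
  refine ⟨c.gradedMoritaEquivalent, fun F M => ?_, ?_, ?_⟩
  · rw [← isIrreducible_map_iff F, GrModule.isIrreducible_iff hB]
    simp
  · rw [Nat.card_eq_two_iff]
    refine ⟨Quot.mk _ ⟨c.irrEven, hS⟩, Quot.mk _ ⟨c.irrOdd, hT⟩, fun h => hne ?_, ?_⟩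
    · let p : Irr A → Prop := Quot.lift (fun M => Nonempty (M.1 ≅ c.irrEven)) fun M N h => by
        obtain ⟨f⟩ := h
        exact propext ⟨fun ⟨g⟩ => ⟨f.symm ≪≫ g⟩, fun ⟨g⟩ => ⟨f ≪≫ g⟩⟩
      have h2 : Nonempty (c.irrEven ≅ c.irrEven) = Nonempty (c.irrOdd ≅ c.irrEven) :=
        congrArg p h
      obtain ⟨f⟩ := c.nonempty_iso_induced_iff.1 (h2.mp ⟨Iso.refl _⟩)
      obtain ⟨g⟩ := c.nonempty_obj_induced_iso (regular B).suspension
      exact ⟨f.symm ≪≫ g⟩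
    · rw [Set.eq_univ_iff_forall]
      intro x
      induction x using Quot.ind with
      | mk M =>
        exact ((c.isIrreducible_iff hB).1 M.2).imp (fun h => Quot.sound h) fun h => Quot.sound h
  · have hcls : irreducibleClasses A = {GrothendieckGroup.mk S, GrothendieckGroup.mk T} := by
      ext x
      rw [Set.mem_insert_iff, Set.mem_singleton_iff]
      constructor
      · rintro ⟨M, hM, rfl⟩
        exact ((c.isIrreducible_iff hB).1 hM).imp
          (fun ⟨f⟩ => GrothendieckGroup.mk_eq_of_iso f)
          (fun ⟨f⟩ => GrothendieckGroup.mk_eq_of_iso f)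
      · rintro (rfl | rfl)
        exacts [⟨S, hS, rfl⟩, ⟨T, hT, rfl⟩]
    -- `dim (e -)₀` and `dim (e -)₁` form a diagonal matrix on `[S]`, `[T]`, with the positive entry
    -- `dim B₀`, because `B₁ = 0`; so `(m, n) ↦ m [S] + n [T]` is injective.
    let φ : ℤ × ℤ →+ GrothendieckGroup A :=
      (zmultiplesHom _ (GrothendieckGroup.mk S)).coprod
        (zmultiplesHom _ (GrothendieckGroup.mk T))
    have hφS : φ (1, 0) = GrothendieckGroup.mk S := by simp [φ]
    have hφT : φ (0, 1) = GrothendieckGroup.mk T := by simp [φ]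
    have hpos := finrank_deg_zero_pos hB
    have h1' : Module.finrank K (B.deg 1) = 0 := by rw [h1]; exact finrank_bot K B
    have hS0 : c.dimHom 0 (GrothendieckGroup.mk S) = Module.finrank K (B.deg 0) :=
      c.dimHom_induced 0 (regular B) _
    have hS1 : c.dimHom 1 (GrothendieckGroup.mk S) = Module.finrank K (B.deg 1) :=
      c.dimHom_induced 1 (regular B) _
    have hT0 : c.dimHom 0 (GrothendieckGroup.mk T) = Module.finrank K (B.deg 1) :=
      c.dimHom_induced 0 (regular B).suspension _
    have hT1 : c.dimHom 1 (GrothendieckGroup.mk T) = Module.finrank K (B.deg 0) :=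
      c.dimHom_induced 1 (regular B).suspension _
    have hinj : Function.Injective φ := by
      rw [injective_iff_map_eq_zero]
      rintro ⟨m, n⟩ hmn
      have e0 := congrArg (c.dimHom 0) hmn
      have e1 := congrArg (c.dimHom 1) hmn
      simp only [φ, AddMonoidHom.coprod_apply, zmultiplesHom_apply, map_add, map_zsmul, map_zero,
        hS0, hS1, hT0, hT1, h1', smul_eq_mul, Nat.cast_zero, mul_zero, add_zero, zero_add,
        mul_eq_zero] at e0 e1
      exact Prod.ext (e0.resolve_right (by omega)) (e1.resolve_right (by omega))
    have hsurj : Function.Surjective φ := by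
      rw [← AddMonoidHom.range_eq_top, eq_top_iff, ← closure_irreducibleClasses,
        AddSubgroup.closure_le, hcls, Set.insert_subset_iff, Set.singleton_subset_iff]
      exact ⟨⟨_, hφS⟩, ⟨_, hφT⟩⟩
    refine ⟨(AddEquiv.ofBijective φ ⟨hinj, hsurj⟩).symm, ?_⟩
    rw [hcls, Set.image_pair]
    congr 1
    · rw [AddEquiv.symm_apply_eq]
      exact hφS.symm
    · rw [Set.singleton_eq_singleton_iff, AddEquiv.symm_apply_eq]
      exact hφT.symm

end FullCorner

/-! ### Clifford algebras of diagonal forms -/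

/-- The Clifford superalgebra of the diagonal form `∑ wᵢ xᵢ²`. -/
noncomputable def diagClifford {K : Type} [Field K] {ι : Type} [Fintype ι] (w : ι → K) :
    Superalgebra K :=
  Superalgebra.ofQuadraticForm (QuadraticMap.weightedSumSquares K w)

/-- The defining relations of the Clifford algebra of a diagonal form: the elements `gᵢ`
anticommute and have squares `wᵢ`. -/
structure IsCliffordFamily {K ι R : Type} [Field K] [Ring R] [Algebra K R] (w : ι → K)
    (g : ι → R) : Prop where
  sq : ∀ i, g i * g i = algebraMap K R (w i)
  anticomm : ∀ i j, i ≠ j → g i * g j = -(g j * g i)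

namespace diagClifford

variable {K : Type} [Field K] {ι κ : Type} [Fintype ι] [Fintype κ]

section gen

variable (w : ι → K)

open Classical in
/-- The generators of the Clifford algebra of a diagonal form. -/
noncomputable def gen (i : ι) : diagClifford w :=
  CliffordAlgebra.ι (QuadraticMap.weightedSumSquares K w) (Pi.single i 1)

theorem gen_mem (i : ι) : gen w i ∈ (diagClifford w).deg 1 :=
  CliffordAlgebra.ι_mem_evenOdd_one _ _

theorem isCliffordFamily_gen : IsCliffordFamily w (gen w) := by
  classical
  constructor
  · intro i
    refine (CliffordAlgebra.ι_sq_scalar _ _).trans (congrArg _ ?_)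
    simp [QuadraticMap.weightedSumSquares_apply, Pi.single_apply]
  · intro i j hij
    have hp : QuadraticMap.polar (QuadraticMap.weightedSumSquares K w) (Pi.single i 1)
        (Pi.single j 1) = 0 := by
      simp only [QuadraticMap.polar, QuadraticMap.weightedSumSquares_apply, Pi.add_apply,
        ← Finset.sum_sub_distrib]
      refine Finset.sum_eq_zero fun k _ => ?_
      obtain rfl | hk := eq_or_ne k i
      · simp [Pi.single_eq_of_ne hij]
      · simp [Pi.single_eq_of_ne hk]
    exact eq_neg_of_add_eq_zero_left <| (CliffordAlgebra.ι_mul_ι_add_swap _ _).trans <|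
      (congrArg _ hp).trans (map_zero _)

variable {w}

/-- Induction by left multiplication with generators. -/
theorem induction {P : diagClifford w → Prop} (one : P 1) (add : ∀ a b, P a → P b → P (a + b))
    (smul : ∀ (k : K) a, P a → P (k • a)) (gen_mul : ∀ i a, P a → P (gen w i * a)) :
    ∀ a, P a := by
  classical
  have h0 : P 0 := by simpa using smul 0 1 one
  have hm : ∀ m : ι → K, CliffordAlgebra.ι (QuadraticMap.weightedSumSquares K w) m =
      ∑ i, m i • gen w i := by
    intro m
    conv_lhs => rw [pi_eq_sum_univ' m, map_sum]
    refine Finset.sum_congr rfl fun i _ => ?_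
    rw [map_smul]
    congr 2
  have key : ∀ (m : ι → K) (x : diagClifford w), P x → P ((∑ i, m i • gen w i) * x) := by
    intro m x hx
    rw [Finset.sum_mul]
    refine Finset.sum_induction _ P add h0 fun i _ => ?_
    rw [smul_mul_assoc]
    exact smul _ _ (gen_mul i x hx)
  intro a
  induction a using CliffordAlgebra.left_induction with
  | algebraMap r =>
    exact (Algebra.algebraMap_eq_smul_one (A := diagClifford w) r).symm ▸ smul r 1 one
  | add x y hx hy => exact add x y hx hy
  | ι_mul x m hx =>
    exact (congrArg (fun y : diagClifford w => P (y * (show diagClifford w from x))) (hm m)).mpr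
      (key m x hx)

theorem hom_ext {R : Type} [Ring R] [Algebra K R] {φ ψ : diagClifford w →ₐ[K] R}
    (h : ∀ i, φ (gen w i) = ψ (gen w i)) : φ = ψ :=
  AlgHom.ext <| induction (by simp) (fun a b ha hb => by simp [ha, hb])
    (fun k a ha => by simp [ha]) fun i a ha => by simp [h, ha]

theorem nontrivial [CharZero K] : Nontrivial (diagClifford w) := by
  have : Invertible (2 : K) := invertibleOfNonzero two_ne_zero
  exact inferInstanceAs (Nontrivial (CliffordAlgebra _))

end gen

section lift

variable [CharZero K] {w : ι → K} {R : Type} [Ring R] [Algebra K R]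

theorem linearCombination_sq {g : ι → R} (h : IsCliffordFamily w g) (v : ι → K) :
    Fintype.linearCombination K g v * Fintype.linearCombination K g v =
      algebraMap K R (QuadraticMap.weightedSumSquares K w v) := by
  classical
  rw [Fintype.linearCombination_apply, QuadraticMap.weightedSumSquares_apply, Finset.sum_mul_sum]
  simp only [smul_mul_smul_comm]
  -- Symmetrising the double sum leaves only the diagonal terms.
  set S := ∑ i, ∑ j, (v i * v j) • (g i * g j)
  have h1 : S + S = ∑ i, ∑ j, (v i * v j) • (g i * g j + g j * g i) := by
    conv_lhs => enter [2]; rw [show S = ∑ j, ∑ i, (v i * v j) • (g i * g j) from Finset.sum_comm]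
    simp only [S, smul_add, Finset.sum_add_distrib]
    congr 1
    exact Finset.sum_congr rfl fun i _ => Finset.sum_congr rfl fun j _ => by rw [mul_comm]
  have h2 : S + S = (2 : K) • algebraMap K R (∑ i, w i • (v i * v i)) := by
    rw [h1, map_sum, Finset.smul_sum]
    refine Finset.sum_congr rfl fun i _ => ?_
    rw [Finset.sum_eq_single i]
    · rw [h.sq, smul_eq_mul, map_mul, two_smul, smul_add, Algebra.smul_def, ← map_mul,
        ← map_mul, mul_comm]
    · intro j _ hj
      rw [h.anticomm i j hj.symm, neg_add_cancel, smul_zero]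
    · simp
  rw [← two_smul K] at h2
  exact smul_right_injective R (two_ne_zero (α := K)) h2

/-- The homomorphism determined by elements satisfying the Clifford relations. -/
noncomputable def lift {g : ι → R} (h : IsCliffordFamily w g) : diagClifford w →ₐ[K] R :=
  CliffordAlgebra.lift (QuadraticMap.weightedSumSquares K w)
    ⟨Fintype.linearCombination K g, linearCombination_sq h⟩

theorem lift_gen {g : ι → R} (h : IsCliffordFamily w g) (i : ι) : lift h (gen w i) = g i := by
  classical
  refine (CliffordAlgebra.lift_ι_apply _ _ _).trans ?_
  convert Fintype.linearCombination_apply_single K g i 1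
  rw [one_smul]

theorem lift_mem {A : Superalgebra K} {g : ι → A} (h : IsCliffordFamily w g)
    (hg : ∀ i, g i ∈ A.deg 1) (i : ZMod 2) (a : diagClifford w)
    (ha : a ∈ (diagClifford w).deg i) : lift h a ∈ A.deg i := by
  let φ : CliffordAlgebra (QuadraticMap.weightedSumSquares K w) →ₐ[K] A := lift h
  have hn : ∀ n : ℕ, LinearMap.range (CliffordAlgebra.ι (QuadraticMap.weightedSumSquares K w)) ^ n ≤
      (A.deg n).comap φ.toLinearMap := by
    intro n
    induction n with
    | zero =>
      rw [pow_zero, Submodule.one_le]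
      change φ 1 ∈ A.deg 0
      rw [map_one]
      exact A.one_mem
    | succ n ih =>
      rw [pow_succ, Submodule.mul_le]
      rintro x hx _ ⟨v, rfl⟩
      change φ (x * CliffordAlgebra.ι _ v) ∈ A.deg ((n + 1 : ℕ) : ZMod 2)
      rw [map_mul, Nat.cast_succ]
      refine A.mul_mem (ih hx) ?_
      have : φ (CliffordAlgebra.ι _ v) = Fintype.linearCombination K g v :=
        CliffordAlgebra.lift_ι_apply _ _ _
      rw [this, Fintype.linearCombination_apply]
      exact sum_mem fun j _ => (A.deg 1).smul_mem _ (hg j)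
  have : CliffordAlgebra.evenOdd (QuadraticMap.weightedSumSquares K w) i ≤
      (A.deg i).comap φ.toLinearMap :=
    iSup_le fun ⟨n, hni⟩ => hni ▸ hn n
  exact this ha

/-- Two Clifford algebras are isomorphic, hence corners of each other, if each contains generators
for the other and the resulting homomorphisms are mutually inverse. -/
theorem nonempty_fullCorner_of_gens {w' : κ → K} {g : ι → diagClifford w'}
    {g' : κ → diagClifford w} (h : IsCliffordFamily w g) (h' : IsCliffordFamily w' g')
    (hg : ∀ i, g i ∈ (diagClifford w').deg 1)
    (h1 : ∀ i, lift h' (g i) = gen w i) (h2 : ∀ k, lift h (g' k) = gen w' k) :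
    Nonempty (FullCorner (diagClifford w) (diagClifford w')) :=
  ⟨.ofAlgEquiv (AlgEquiv.ofAlgHom (lift h) (lift h')
    (hom_ext fun k => by simp [lift_gen, h2]) (hom_ext fun i => by simp [lift_gen, h1]))
    (lift_mem h hg)⟩

/-- Reindexing and rescaling the generators. -/
theorem nonempty_fullCorner_of_equiv {w' : κ → K} (σ : ι ≃ κ) (c : ι → K) (hc : ∀ i, c i ≠ 0)
    (hw : ∀ i, w i = c i * c i * w' (σ i)) :
    Nonempty (FullCorner (diagClifford w) (diagClifford w')) := by
  have G := isCliffordFamily_gen w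
  have G' := isCliffordFamily_gen w'
  have h : IsCliffordFamily w fun i => c i • gen w' (σ i) := by
    constructor
    · intro i
      rw [smul_mul_smul_comm, G'.sq, hw, map_mul, Algebra.smul_def]
    · intro i j hij
      rw [smul_mul_smul_comm, smul_mul_smul_comm, G'.anticomm _ _ (σ.injective.ne hij), smul_neg,
        mul_comm]
  have h' : IsCliffordFamily w' fun k => (c (σ.symm k))⁻¹ • gen w (σ.symm k) := by
    constructor
    · intro k
      have hk := hc (σ.symm k)
      rw [smul_mul_smul_comm, G.sq, hw, σ.apply_symm_apply, Algebra.smul_def, ← map_mul]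
      congr 1
      field_simp
    · intro i j hij
      rw [smul_mul_smul_comm, smul_mul_smul_comm, G.anticomm _ _ (σ.symm.injective.ne hij),
        smul_neg, mul_comm]
  refine nonempty_fullCorner_of_gens h h' (fun i => Submodule.smul_mem _ _ (gen_mem _ _))
    (fun i => ?_) fun k => ?_
  · rw [map_smul, lift_gen, σ.symm_apply_apply, smul_inv_smul₀ (hc i)]
  · rw [map_smul, lift_gen, σ.apply_symm_apply, inv_smul_smul₀ (hc _)]

end lift

end diagClifford

/-! ### Products of four generators -/

namespace IsCliffordFamily

variable {K ι R : Type} [Field K] [Ring R] [Algebra K R]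

section order
variable {w : ι → K} {g : ι → R} (h : IsCliffordFamily w g)
include h

theorem mul_self (i : ι) : g i * g i = w i • (1 : R) := by
  rw [h.sq, Algebra.algebraMap_eq_smul_one]

theorem mul_self_assoc (i : ι) (z : R) : g i * (g i * z) = w i • z := by
  rw [← mul_assoc, h.mul_self, smul_mul_assoc, one_mul]

theorem anticomm_assoc (i j : ι) (hij : i ≠ j) (z : R) : g i * (g j * z) = -(g j * (g i * z)) := by
  rw [← mul_assoc, h.anticomm i j hij, neg_mul, mul_assoc]

theorem swap [LinearOrder ι] (i j : ι) (hij : j < i) : g i * g j = -(g j * g i) :=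
  h.anticomm i j hij.ne'

theorem swap_assoc [LinearOrder ι] (i j : ι) (hij : j < i) (z : R) :
    g i * (g j * z) = -(g j * (g i * z)) :=
  h.anticomm_assoc i j hij.ne' z

end order

/-- The product of four elements. For anticommuting elements of equal square `±1` it has square `1`
and anticommutes with each of them. -/
def vol (g : Fin 4 → R) : R := g 0 * g 1 * g 2 * g 3

variable {s : K} {g : Fin 4 → R} (h : IsCliffordFamily (fun _ => s) g)
include h

theorem vol_mul_vol (hs : s * s = 1) : vol g * vol g = 1 := by
  simp [vol, mul_assoc, h.swap_assoc, h.mul_self, smul_smul, hs]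

theorem mul_vol (i : Fin 4) : g i * vol g = -(vol g * g i) := by
  fin_cases i <;>
    simp [vol, mul_assoc, h.swap, h.swap_assoc, h.mul_self, h.mul_self_assoc]

theorem vol_mul_right (hs : s * s = 1) : vol (fun i => g i * vol g) = vol g := by
  have h1 := h.vol_mul_vol hs
  have h2 : ∀ i z, vol g * (g i * z) = -(g i * (vol g * z)) := fun i z => by
    rw [← mul_assoc, ← mul_assoc, h.mul_vol, neg_mul, neg_neg]
  have h3 : ∀ z, vol g * (vol g * z) = z := fun z => by rw [← mul_assoc, h1, one_mul]
  simp only [vol.eq_1 fun i => g i * vol g, mul_assoc, h2, mul_neg]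
  rw [h1]
  simp only [vol, mul_assoc, mul_one, neg_mul, neg_neg]

theorem mul_right_vol (hs : s * s = 1) :
    IsCliffordFamily (fun _ => -s) (fun i => g i * vol g) := by
  have h1 := h.vol_mul_vol hs
  have h2 : ∀ i j, g i * vol g * (g j * vol g) = -(g i * g j) := fun i j => by
    rw [mul_assoc, ← mul_assoc (vol g), ← neg_eq_iff_eq_neg.2 (h.mul_vol j), neg_mul, mul_assoc,
      h1, mul_one, mul_neg]
  constructor
  · intro i
    rw [h2, h.sq, map_neg]
  · intro i j hij
    rw [h2, h2, h.anticomm i j hij]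

omit h

/-- The family in which the last four members are multiplied by their product. -/
def twist (g : ι ⊕ Fin 4 → R) : ι ⊕ Fin 4 → R :=
  Sum.elim (fun i => g (.inl i)) fun k => g (.inr k) * vol fun k => g (.inr k)

variable {w : ι → K} {g : ι ⊕ Fin 4 → R}

theorem comp {κ : Type} {w : ι → K} {g : ι → R} (h : IsCliffordFamily w g) {f : κ → ι}
    (hf : Function.Injective f) : IsCliffordFamily (fun k => w (f k)) fun k => g (f k) where
  sq k := h.sq (f k)
  anticomm _ _ hij := h.anticomm _ _ (hf.ne hij)

theorem twist_isCliffordFamily (h : IsCliffordFamily (Sum.elim w fun _ => s) g) (hs : s * s = 1) :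
    IsCliffordFamily (Sum.elim w fun _ => -s) (twist g) := by
  have h4 : IsCliffordFamily (fun _ => s) fun k => g (.inr k) := h.comp Sum.inr_injective
  have hc : ∀ i, g (.inl i) * vol (fun k => g (.inr k)) =
      vol (fun k => g (.inr k)) * g (.inl i) := by
    intro i
    simp only [vol, mul_assoc]
    rw [h.anticomm_assoc _ _ Sum.inl_ne_inr, h.anticomm_assoc _ _ Sum.inl_ne_inr,
      h.anticomm_assoc _ _ Sum.inl_ne_inr, h.anticomm _ _ Sum.inl_ne_inr]
    simp only [mul_neg, neg_neg]
  have h5 := h4.mul_right_vol hs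
  constructor
  · rintro (i | k)
    exacts [h.sq (.inl i), h5.sq k]
  · rintro (i | k) (j | l) hij
    · exact h.anticomm _ _ hij
    · simp only [twist, Sum.elim_inl, Sum.elim_inr]
      rw [mul_assoc, ← hc, ← mul_assoc, ← mul_assoc, h.anticomm _ _ Sum.inl_ne_inr, neg_mul]
    · simp only [twist, Sum.elim_inl, Sum.elim_inr]
      rw [mul_assoc, ← hc, ← mul_assoc, ← mul_assoc, h.anticomm _ _ Sum.inr_ne_inl, neg_mul]
    · exact h5.anticomm k l fun hkl => hij (congrArg _ hkl)

theorem twist_twist (h : IsCliffordFamily (Sum.elim w fun _ => s) g) (hs : s * s = 1)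
    (i : ι ⊕ Fin 4) : twist (twist g) i = g i := by
  have h4 : IsCliffordFamily (fun _ => s) fun k => g (.inr k) := h.comp Sum.inr_injective
  obtain i | k := i
  · rfl
  · simp only [twist, Sum.elim_inr]
    rw [h4.vol_mul_right hs, mul_assoc, h4.vol_mul_vol hs, mul_one]

theorem map_twist {S : Type} [Ring S] [Algebra K S] (φ : R →ₐ[K] S) (i : ι ⊕ Fin 4) :
    φ (twist g i) = twist (fun i => φ (g i)) i := by
  obtain i | k := i
  · rfl
  · simp [twist, vol]

end IsCliffordFamily

namespace diagClifford

variable {K : Type} [Field K] [CharZero K] {ι : Type} [Fintype ι]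

/-- Multiplying four anticommuting generators of square `s = ±1` by their product gives four
anticommuting generators of square `-s`. -/
theorem nonempty_fullCorner_neg_four (w : ι → K) {s : K} (hs : s * s = 1) :
    Nonempty (FullCorner (diagClifford (Sum.elim w fun _ : Fin 4 => s))
      (diagClifford (Sum.elim w fun _ : Fin 4 => -s))) := by
  have G := isCliffordFamily_gen (Sum.elim w fun _ : Fin 4 => s)
  have G' := isCliffordFamily_gen (Sum.elim w fun _ : Fin 4 => -s)
  have hs' : -s * -s = 1 := by rw [neg_mul_neg, hs]
  have h := G'.twist_isCliffordFamily hs'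
  rw [neg_neg] at h
  have h' := G.twist_isCliffordFamily hs
  refine nonempty_fullCorner_of_gens h h' (fun i => ?_) (fun i => ?_) fun i => ?_
  · obtain i | k := i
    · exact gen_mem _ _
    · have hm := fun k : Fin 4 => gen_mem (Sum.elim w fun _ : Fin 4 => -s) (.inr k)
      have := Superalgebra.mul_mem _ (hm k) (Superalgebra.mul_mem _ (Superalgebra.mul_mem _
        (Superalgebra.mul_mem _ (hm 0) (hm 1)) (hm 2)) (hm 3))
      rwa [show (1 : ZMod 2) + (1 + 1 + 1 + 1) = 1 by decide] at this
  · rw [IsCliffordFamily.map_twist]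
    simp only [lift_gen]
    exact G.twist_twist hs i
  · rw [IsCliffordFamily.map_twist]
    simp only [lift_gen]
    exact G'.twist_twist hs' i

/-! ### Splitting off a hyperbolic plane -/

section hyperbolic

/-- Generators of squares `1` and `-1` are the sum and the difference of a hyperbolic pair. -/
theorem exists_hyperbolic_pair {R : Type} [Ring R] [Algebra K R] {f f' : R} (hff : f * f = 1)
    (hff' : f' * f' = -1) (hff2 : f' * f = -(f * f')) :
    ∃ x y : R, x = (2⁻¹ : K) • (f + f') ∧ y = (2⁻¹ : K) • (f - f') ∧ f = x + y ∧ f' = x - y ∧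
      x * x = 0 ∧ y * y = 0 ∧ x * y + y * x = 1 := by
  obtain ⟨x, hx⟩ : ∃ x, x = (2⁻¹ : K) • (f + f') := ⟨_, rfl⟩
  obtain ⟨y, hy⟩ : ∃ y, y = (2⁻¹ : K) • (f - f') := ⟨_, rfl⟩
  have hfx : f = x + y := by
    rw [hx, hy, ← smul_add, add_add_sub_cancel, ← two_smul K f, smul_smul,
      inv_mul_cancel₀ two_ne_zero, one_smul]
  have hfy : f' = x - y := by
    rw [hx, hy, ← smul_sub, add_sub_sub_cancel, ← two_smul K f', smul_smul,
      inv_mul_cancel₀ two_ne_zero, one_smul]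
  have hxx : x * x = 0 := by
    rw [hx, smul_mul_smul_comm, add_mul, mul_add, mul_add, hff, hff', hff2]
    simp
  have hyy : y * y = 0 := by
    rw [hy, smul_mul_smul_comm, sub_mul, mul_sub, mul_sub, hff, hff', hff2, neg_sub_neg, sub_self,
      smul_zero]
  have hxy : x * y + y * x = 1 := by
    rw [hx, hy, smul_mul_smul_comm, smul_mul_smul_comm, ← smul_add]
    have : (f + f') * (f - f') + (f - f') * (f + f') = (4 : K) • 1 := by
      rw [add_mul, mul_sub, mul_sub, sub_mul, mul_add, mul_add, hff, hff', hff2,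
        show (4 : K) = 1 + 1 + 1 + 1 by norm_num]
      simp only [add_smul, one_smul]
      abel
    rw [this, smul_smul]
    norm_num
  exact ⟨x, y, hx, hy, hfx, hfy, hxx, hyy, hxy⟩

variable (w : ι → K)

/-- The weights `w` together with `1` and `-1`. -/
def addPlane (w : ι → K) : ι ⊕ (Fin 1 ⊕ Fin 1) → K :=
  Sum.elim w (Sum.elim (fun _ => 1) fun _ => -1)

omit [CharZero K] in
/-- The representation of the Clifford algebra of `w ⊕ ⟨1, -1⟩` on `2 × 2` matrices over the
Clifford algebra of `w`. -/
theorem isCliffordFamily_matrix : IsCliffordFamily (addPlane w)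
    (Sum.elim (fun i => !![gen w i, 0; 0, -gen w i])
      (Sum.elim (fun _ => !![0, 1; 1, 0]) fun _ => !![0, 1; -1, 0]) :
      _ → Matrix (Fin 2) (Fin 2) (diagClifford w)) := by
  have G := isCliffordFamily_gen w
  have hsc : ∀ k : K, algebraMap K (Matrix (Fin 2) (Fin 2) (diagClifford w)) k =
      !![algebraMap K _ k, 0; 0, algebraMap K _ k] := fun k => by
    ext i j
    fin_cases i <;> fin_cases j <;> simp [Matrix.algebraMap_matrix_apply]
  constructor
  · rintro (i | i | i) <;> simp [addPlane, hsc, G.sq]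
  · rintro (i | i | i) (j | j | j) hij
    · simp [G.anticomm i j fun h => hij (congrArg _ h)]
    all_goals first
      | exact absurd (congrArg _ (congrArg _ (Subsingleton.elim i j))) hij
      | simp

/-- The Clifford algebra of `w` is the corner of the Clifford algebra of `w ⊕ ⟨1, -1⟩` at `e = x y`,
where `x` and `y` are isotropic vectors of the hyperbolic plane with `x y + y x = 1`. -/
theorem nonempty_fullCorner_addPlane :
    Nonempty (FullCorner (diagClifford w) (diagClifford (addPlane w))) := by
  have G := isCliffordFamily_gen w
  have H := isCliffordFamily_gen (addPlane w)
  have hinl : IsCliffordFamily w fun i => gen (addPlane w) (.inl i) := H.comp Sum.inl_injective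
  have hneg : IsCliffordFamily w fun i => -gen w i := by
    constructor
    · intro i; rw [neg_mul_neg, G.sq]
    · intro i j hij; rw [neg_mul_neg, neg_mul_neg, G.anticomm i j hij]
  let inc : diagClifford w →ₐ[K] diagClifford (addPlane w) := lift hinl
  let inv : diagClifford w →ₐ[K] diagClifford w := lift hneg
  have hinc : ∀ i, inc (gen w i) = gen (addPlane w) (.inl i) := lift_gen hinl
  have hinv : ∀ i, inv (gen w i) = -gen w i := lift_gen hneg
  set f : diagClifford (addPlane w) := gen (addPlane w) (.inr (.inl 0)) with hf
  set f' : diagClifford (addPlane w) := gen (addPlane w) (.inr (.inr 0)) with hf'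
  have hff : f * f = 1 := by rw [hf, H.sq]; exact map_one _
  have hff' : f' * f' = -1 := by rw [hf', H.sq]; exact (map_neg _ _).trans (by rw [map_one])
  have hff2 : f' * f = -(f * f') := H.anticomm _ _ (by simp)
  obtain ⟨x, y, hx, hy, hfx, hfy, hxx, hyy, hxy⟩ := exists_hyperbolic_pair (K := K) hff hff' hff2
  obtain ⟨e, he⟩ : ∃ e, e = x * y := ⟨_, rfl⟩
  have hyx : y * x = 1 - e := by rw [he, ← hxy, add_sub_cancel_left]
  have hxe : x * e = 0 := by rw [he, ← mul_assoc, hxx, zero_mul]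
  have hey : e * y = 0 := by rw [he, mul_assoc, hyy, mul_zero]
  have hye : y * e = y := by rw [he, ← mul_assoc, hyx, sub_mul, one_mul, hey, sub_zero]
  have hee : e * e = e := by
    have : e * e = x * y * e := by rw [← he]
    rw [this, mul_assoc, hye, ← he]
  have hxm : x ∈ (diagClifford (addPlane w)).deg 1 :=
    hx ▸ Submodule.smul_mem _ _ (add_mem (gen_mem _ _) (gen_mem _ _))
  have hym : y ∈ (diagClifford (addPlane w)).deg 1 :=
    hy ▸ Submodule.smul_mem _ _ (sub_mem (gen_mem _ _) (gen_mem _ _))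
  have hem : e ∈ (diagClifford (addPlane w)).deg 0 := by
    have := Superalgebra.mul_mem _ hxm hym
    rwa [show (1 : ZMod 2) + 1 = 0 by decide, ← he] at this
  -- `x` and `y` anticommute with the generators of `w`, so they commute with its Clifford algebra
  -- up to the parity automorphism.
  have hxg : ∀ i, x * gen (addPlane w) (.inl i) = -(gen (addPlane w) (.inl i) * x) := fun i => by
    rw [hx, smul_mul_assoc, mul_smul_comm, add_mul, mul_add, H.anticomm _ _ Sum.inr_ne_inl,
      H.anticomm _ _ Sum.inr_ne_inl, ← smul_neg, neg_add]
  have hyg : ∀ i, y * gen (addPlane w) (.inl i) = -(gen (addPlane w) (.inl i) * y) := fun i => by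
    rw [hy, smul_mul_assoc, mul_smul_comm, sub_mul, mul_sub, H.anticomm _ _ Sum.inr_ne_inl,
      H.anticomm _ _ Sum.inr_ne_inl, ← smul_neg, neg_sub_neg, neg_sub]
  have hcomm : ∀ z : diagClifford (addPlane w),
      (∀ i, z * gen (addPlane w) (.inl i) = -(gen (addPlane w) (.inl i) * z)) →
      ∀ a, z * inc a = inc (inv a) * z := fun z hz => by
    refine induction (by simp) (fun a b ha hb => ?_) (fun k a ha => ?_) fun i a ha => ?_
    · simp only [map_add, mul_add, add_mul, ha, hb]
    · simp only [map_smul, mul_smul_comm, smul_mul_assoc, ha]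
    · rw [map_mul, map_mul, map_mul, hinc, hinv, ← mul_assoc, hz, neg_mul, mul_assoc, ha, map_neg,
        hinc, neg_mul, neg_mul, mul_assoc]
  have hxc := hcomm x hxg
  have hyc := hcomm y hyg
  have hinvinv : ∀ a, inv (inv a) = a := fun a => by
    have : inv.comp inv = AlgHom.id K _ := hom_ext fun i => by simp [hinv]
    exact DFunLike.congr_fun this a
  have hec : ∀ a, e * inc a = inc a * e := fun a => by
    rw [he, mul_assoc, hyc, ← mul_assoc, hxc, hinvinv, mul_assoc]
  -- Since `x e = 0`, `y e = y` and `e = x y`, left multiplication by the generators preserves the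
  -- sum of `A' e` and `A' y`, where `A'` is the Clifford algebra of `w`; so `A e` is that sum.
  have hdec : ∀ a : diagClifford (addPlane w), ∃ p q, a * e = inc p * e + inc q * y := by
    have hstep : ∀ p q, x * (inc p * e + inc q * y) = inc (inv q) * e := fun p q => by
      rw [mul_add, ← mul_assoc, hxc, mul_assoc, hxe, mul_zero, zero_add, ← mul_assoc, hxc,
        mul_assoc, ← he]
    have hstep' : ∀ p q, y * (inc p * e + inc q * y) = inc (inv p) * y := fun p q => by
      rw [mul_add, ← mul_assoc, hyc, mul_assoc, hye, ← mul_assoc, hyc, mul_assoc _ y, hyy,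
        mul_zero, add_zero]
    refine induction ⟨1, 0, by simp⟩ ?_ ?_ ?_
    · rintro a b ⟨p, q, ha⟩ ⟨p', q', hb⟩
      exact ⟨p + p', q + q', by rw [add_mul, ha, hb, map_add, map_add, add_mul, add_mul]; abel⟩
    · rintro k a ⟨p, q, ha⟩
      exact ⟨k • p, k • q, by
        rw [smul_mul_assoc, ha, smul_add, map_smul, map_smul, smul_mul_assoc, smul_mul_assoc]⟩
    · rintro (i | i | i) a ⟨p, q, ha⟩
      · exact ⟨gen w i * p, gen w i * q, by
          rw [mul_assoc, ha, map_mul, map_mul, hinc, mul_add, mul_assoc, mul_assoc]⟩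
      · refine ⟨inv q, inv p, ?_⟩
        rw [Subsingleton.elim i 0, ← hf, hfx, mul_assoc, ha, add_mul, hstep, hstep']
      · refine ⟨inv q, -inv p, ?_⟩
        rw [Subsingleton.elim i 0, ← hf', hfy, mul_assoc, ha, sub_mul, hstep, hstep', map_neg,
          neg_mul, sub_eq_add_neg]
  -- The upper left entry of the matrix representation recovers `a` from `inc a * e`.
  let ρ := lift (isCliffordFamily_matrix w)
  have hρ : ∀ a, ρ (inc a) 0 0 = a ∧ ρ (inc a) 0 1 = 0 := by
    refine induction (by simp) (fun a b ha hb => ?_) (fun k a ha => ?_) fun i a ha => ?_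
    · simp [ha, hb]
    · simp [ha]
    · have : ρ (gen (addPlane w) (.inl i)) = !![gen w i, 0; 0, -gen w i] := lift_gen _ _
      simp [hinc, this, Matrix.mul_apply, Fin.sum_univ_two, ha]
  have hρe : ρ e 0 0 = 1 := by
    have h1 : ρ f = !![0, 1; 1, 0] := lift_gen _ _
    have h2 : ρ f' = !![0, 1; -1, 0] := lift_gen _ _
    have h3 : (2 : K) • e = 1 - f * f' := by
      have h4 : f * f' = y * x - x * y := by
        rw [hfx, hfy, add_mul, mul_sub, mul_sub, hxx, hyy]
        abel
      rw [h4, hyx, ← he, two_smul]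
      abel
    have h5 : (2 : K) • ρ e 0 0 = (2 : K) • 1 := by
      rw [← Matrix.smul_apply, ← map_smul, h3, map_sub, map_mul, h1, h2, two_smul]
      simp
    exact smul_right_injective _ (two_ne_zero (α := K)) h5
  refine ⟨
    { toFun := (LinearMap.mulRight K e).comp inc.toLinearMap
      injective := fun a b hab => ?_
      map_mul := fun a b => ?_
      map_deg := fun i a ha => ?_
      exists_eq := fun a => ?_
      full := ?_ }⟩
  · have h : inc a * e = inc b * e := hab
    have h' := congrArg (fun m => ρ m 0 0) h
    simpa [Matrix.mul_apply, Fin.sum_univ_two, hρ, hρe] using h'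
  · change inc (a * b) * e = inc a * e * (inc b * e)
    rw [mul_assoc, ← mul_assoc e, hec, mul_assoc _ e, hee, map_mul, mul_assoc]
  · have := Superalgebra.mul_mem _ (lift_mem hinl (fun i => gen_mem _ _) i a ha) hem
    rwa [add_zero] at this
  · obtain ⟨p, q, ha⟩ := hdec a
    refine ⟨p, ?_⟩
    change inc p * e = inc 1 * e * a * (inc 1 * e)
    rw [map_one, one_mul, mul_assoc, ha, mul_add, ← mul_assoc, hec, mul_assoc, hee, ← mul_assoc,
      hec, mul_assoc, hey, mul_zero, add_zero]
  · change (1 : diagClifford (addPlane w)) ∈ Submodule.span K {z | ∃ i, ∃ a ∈ _, ∃ b ∈ _,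
      z = a * (inc 1 * e) * b}
    rw [← hxy, map_one, one_mul]
    refine add_mem (Submodule.subset_span ⟨0, 1, Superalgebra.one_mem _, 1,
      Superalgebra.one_mem _, ?_⟩) (Submodule.subset_span ⟨1, y, hym, x, hxm, ?_⟩)
    · rw [one_mul, mul_one, he]
    · rw [hye]

end hyperbolic

end diagClifford

/-! ### Graded division superalgebras of the form `D ⊕ u D` -/

theorem Superalgebra.algebraMap_mem {K : Type} [Field K] (A : Superalgebra K) (k : K) :
    algebraMap K A k ∈ A.deg 0 := by
  rw [Algebra.algebraMap_eq_smul_one]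
  exact (A.deg 0).smul_mem k A.one_mem

/-- A finite dimensional graded division superalgebra with non-zero odd part. -/
structure Superalgebra.IsOddGradedDivision {K : Type} [Field K] (B : Superalgebra K) : Prop where
  isGradedDivision : B.IsGradedDivision
  finiteDimensional : FiniteDimensional K B
  odd_ne_bot : B.deg 1 ≠ ⊥

/-- The even elements of `Φ(D) + u Φ(D)` are those of `Φ(D)`, the odd ones those of `u Φ(D)`; the
former are invertible since `D` is a division ring, the latter since also `u² = s ≠ 0`. -/
theorem Superalgebra.isOddGradedDivision_of_eq_add {K D : Type} [Field K] [DivisionRing D]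
    [Algebra K D] [FiniteDimensional K D] {B : Superalgebra K} [Nontrivial B] (Φ : D →ₐ[K] B)
    (hΦ : ∀ d, Φ d ∈ B.deg 0) {u : B} (hu : u ∈ B.deg 1) {s : K} (hs : s ≠ 0)
    (huu : u * u = algebraMap K B s) (hB : ∀ b, ∃ d d', b = Φ d + u * Φ d') :
    B.IsOddGradedDivision := by
  have hinv : ∀ d, d ≠ 0 → Φ d⁻¹ * Φ d = 1 := fun d hd => by
    rw [← map_mul, inv_mul_cancel₀ hd, map_one]
  have huΦ : ∀ d, u * Φ d ∈ B.deg 1 := fun d => by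
    have := B.mul_mem hu (hΦ d)
    rwa [add_zero] at this
  have hsu : algebraMap K B s⁻¹ * u * u = 1 := by
    rw [mul_assoc, huu, ← map_mul, inv_mul_cancel₀ hs, map_one]
  refine ⟨⟨inferInstance, fun i b hb hb0 => ?_⟩, ?_, fun h => ?_⟩
  · obtain ⟨d, d', rfl⟩ := hB b
    obtain rfl | rfl := GrModule.zero_or_one i
    · have h0 : u * Φ d' = 0 := B.eq_zero_of_mem (i := 0)
        (by simpa using sub_mem hb (hΦ d)) (huΦ d')
      rw [h0, add_zero] at hb0 ⊢
      exact ⟨Φ d⁻¹, hinv d fun h => hb0 (by rw [h, map_zero])⟩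
    · have h0 : Φ d = 0 := B.eq_zero_of_mem (i := 0) (hΦ d)
        (by simpa using sub_mem hb (huΦ d'))
      rw [h0, zero_add] at hb0 ⊢
      refine ⟨Φ d'⁻¹ * (algebraMap K B s⁻¹ * u), ?_⟩
      rw [mul_assoc, ← mul_assoc _ u, hsu, one_mul]
      exact hinv d' fun h => hb0 (by rw [h, map_zero, mul_zero])
  · refine Module.Finite.of_surjective
      (Φ.toLinearMap.coprod (LinearMap.mulLeft K u ∘ₗ Φ.toLinearMap))
      fun b => ?_
    obtain ⟨d, d', h⟩ := hB b
    exact ⟨(d, d'), h.symm⟩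
  · rw [h] at hu
    rw [(Submodule.mem_bot K).1 hu, mul_zero] at hsu
    exact zero_ne_one hsu

theorem Superalgebra.concentrated_isGradedDivision {K D : Type} [Field K] [DivisionRing D]
    [Algebra K D] : (Superalgebra.concentrated K D).IsGradedDivision :=
  ⟨inferInstanceAs (Nontrivial D), fun _ (b : D) _ hb => ⟨(b⁻¹ : D), inv_mul_cancel₀ (G₀ := D) hb⟩⟩

theorem Superalgebra.concentrated_deg_one {K R : Type} [Field K] [Ring R] [Algebra K R] :
    (Superalgebra.concentrated K R).deg 1 = ⊥ :=
  if_neg (show ¬(1 : ZMod 2) = 0 by decide) (t := (⊤ : Submodule K R))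

namespace IsCliffordFamily

variable {R : Type} [Ring R] [Algebra ℝ R] {s : ℝ} {g : Fin 3 → R}
  (h : IsCliffordFamily (fun _ => s) g) (hs : s * s = 1)

include h hs in
theorem mul_mul_self {i j : Fin 3} (hij : i ≠ j) : g i * g j * (g i * g j) = -1 := by
  rw [mul_assoc, h.anticomm_assoc j i hij.symm, h.mul_self, mul_neg, mul_smul_comm, mul_smul_comm,
    mul_one, h.mul_self, smul_smul, hs, one_smul]

/-- The even products of three anticommuting elements of square `s = ±1` form a basis of
quaternions. -/
def quaternionBasis : QuaternionAlgebra.Basis R (-1 : ℝ) 0 (-1) where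
  i := g 0 * g 1
  j := g 0 * g 2
  k := g 0 * g 1 * (g 0 * g 2)
  i_mul_i := by simp [h.mul_mul_self hs]
  j_mul_j := by simp [h.mul_mul_self hs]
  i_mul_j := rfl
  j_mul_i := by
    simp [mul_assoc, h.swap, h.swap_assoc, h.mul_self_assoc]

/-- The homomorphism from the quaternions determined by three anticommuting elements of square
`s = ±1`. -/
noncomputable def quaternionHom : Quaternion ℝ →ₐ[ℝ] R := (h.quaternionBasis hs).liftHom

theorem quaternionHom_apply (x : Quaternion ℝ) : h.quaternionHom hs x =
    algebraMap ℝ R x.re + x.imI • (g 0 * g 1) + x.imJ • (g 0 * g 2) +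
      x.imK • (g 0 * g 1 * (g 0 * g 2)) := rfl

theorem exists_quaternionHom_I : ∃ x, h.quaternionHom hs x = g 0 * g 1 :=
  ⟨⟨0, 1, 0, 0⟩, (h.quaternionHom_apply hs _).trans (by simp)⟩

theorem exists_quaternionHom_J : ∃ x, h.quaternionHom hs x = g 0 * g 2 :=
  ⟨⟨0, 0, 1, 0⟩, (h.quaternionHom_apply hs _).trans (by simp)⟩

theorem quaternionHom_mem {A : Superalgebra ℝ} {g : Fin 3 → A}
    (h : IsCliffordFamily (fun _ => s) g) (hg : ∀ i, g i ∈ A.deg 1) (x : Quaternion ℝ) :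
    h.quaternionHom hs x ∈ A.deg 0 := by
  have h2 : ∀ i j, g i * g j ∈ A.deg 0 := fun i j => by
    have := A.mul_mem (hg i) (hg j)
    rwa [show (1 : ZMod 2) + 1 = 0 by decide] at this
  have h4 : g 0 * g 1 * (g 0 * g 2) ∈ A.deg 0 := by
    have := A.mul_mem (h2 0 1) (h2 0 2)
    rwa [add_zero] at this
  rw [quaternionHom_apply]
  exact add_mem (add_mem (add_mem (A.algebraMap_mem _) (Submodule.smul_mem _ _ (h2 _ _)))
    (Submodule.smul_mem _ _ (h2 _ _))) (Submodule.smul_mem _ _ h4)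

end IsCliffordFamily

namespace diagClifford

/-- Let `u` be one of the generators. If, modulo an idempotent `e` commuting with `Φ(D)`, every
generator lies in `u Φ(D)`, then every element lies in `Φ(D) + u Φ(D)` modulo `e`. -/
theorem exists_eq_add {K D ι : Type} [Field K] [Ring D] [Algebra K D] [Fintype ι] {w : ι → K}
    (Φ : D →ₐ[K] diagClifford w) {e : diagClifford w} (i₀ : ι) (he : ∀ d, Φ d * e = e * Φ d)
    (h : ∀ i, ∃ α, gen w i * e = gen w i₀ * (Φ α * e)) :
    ∀ a, ∃ d d', a * e = Φ d * e + gen w i₀ * (Φ d' * e) := by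
  have G := isCliffordFamily_gen w
  set u := gen w i₀
  have h2 : ∀ i, ∃ β, gen w i * (u * e) = Φ β * e := fun i => by
    obtain rfl | hi := eq_or_ne i i₀
    · exact ⟨algebraMap K D (w i), by rw [← mul_assoc, G.sq, Φ.commutes]⟩
    · obtain ⟨α, hα⟩ := h i
      refine ⟨-(w i₀ • α), ?_⟩
      rw [G.anticomm_assoc _ _ hi, hα, G.mul_self_assoc, map_neg, map_smul, neg_mul,
        smul_mul_assoc]
  refine induction ⟨1, 0, by simp⟩ ?_ ?_ ?_
  · rintro a b ⟨d, d', ha⟩ ⟨c, c', hb⟩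
    refine ⟨d + c, d' + c', ?_⟩
    rw [add_mul, ha, hb]
    simp only [map_add, add_mul, mul_add]
    abel
  · rintro k a ⟨d, d', ha⟩
    refine ⟨k • d, k • d', ?_⟩
    rw [smul_mul_assoc, ha]
    simp only [map_smul, smul_mul_assoc, mul_smul_comm, smul_add]
  · rintro i a ⟨d, d', ha⟩
    obtain ⟨α, hα⟩ := h i
    obtain ⟨β, hβ⟩ := h2 i
    refine ⟨β * d', α * d, ?_⟩
    have e1 : gen w i * (Φ d * e) = u * (Φ (α * d) * e) := by
      rw [he, ← mul_assoc, hα, map_mul]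
      simp only [mul_assoc, he d]
    have e2 : gen w i * (u * (Φ d' * e)) = Φ (β * d') * e := by
      rw [he, ← mul_assoc u, ← mul_assoc, hβ, map_mul]
      simp only [mul_assoc, he d']
    rw [mul_assoc, ha, mul_add, e1, e2, add_comm]

theorem isOddGradedDivision {K D ι : Type} [Field K] [CharZero K] [DivisionRing D] [Algebra K D]
    [FiniteDimensional K D] [Fintype ι] {w : ι → K} (Φ : D →ₐ[K] diagClifford w)
    (hΦ : ∀ d, Φ d ∈ (diagClifford w).deg 0) (i₀ : ι) (hs : w i₀ ≠ 0)
    (h : ∀ i, ∃ α, gen w i = gen w i₀ * Φ α) : (diagClifford w).IsOddGradedDivision := by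
  have := nontrivial (w := w)
  refine Superalgebra.isOddGradedDivision_of_eq_add Φ hΦ (gen_mem w i₀) hs
    ((isCliffordFamily_gen w).sq i₀) fun b => ?_
  simpa using exists_eq_add Φ (e := 1) i₀ (by simp) (by simpa using h) b

/-- One generator of square `±1`: here `D` is the base field. -/
theorem isOddGradedDivision_one {K ι : Type} [Field K] [CharZero K] [Fintype ι] {w : ι → K}
    (σ : Fin 1 ≃ ι) {s : K} (hs : s * s = 1) (hw : ∀ i, w i = s) :
    (diagClifford w).IsOddGradedDivision := by
  have hs0 : s ≠ 0 := left_ne_zero_of_mul_eq_one hs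
  have h0 : ∀ i, i = σ 0 := fun i => by
    rw [← σ.apply_symm_apply i, Subsingleton.elim (σ.symm i) 0]
  refine isOddGradedDivision (Algebra.ofId K (diagClifford w)) (Superalgebra.algebraMap_mem _)
    (σ 0) (by rwa [hw]) fun i => ⟨1, ?_⟩
  rw [h0 i, map_one, mul_one]

/-- A definite form in two variables: `D = ℂ`, with `i` the product of the two generators. -/
theorem isOddGradedDivision_two {ι : Type} [Fintype ι] {w : ι → ℝ} (σ : Fin 2 ≃ ι) {s : ℝ}
    (hs : s * s = 1) (hw : ∀ i, w i = s) : (diagClifford w).IsOddGradedDivision := by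
  have hs0 : s ≠ 0 := left_ne_zero_of_mul_eq_one hs
  have hG := isCliffordFamily_gen w
  have hne : σ 0 ≠ σ 1 := σ.injective.ne (by decide)
  set a := gen w (σ 0)
  set b := gen w (σ 1)
  have haa : ∀ z, a * (a * z) = s • z := fun z => by rw [hG.mul_self_assoc, hw]
  have hbb : b * b = s • 1 := by rw [hG.mul_self, hw]
  have hI : a * b * (a * b) = -1 := by
    rw [mul_assoc, hG.anticomm_assoc _ _ hne.symm, hbb, mul_neg, mul_smul_comm, mul_smul_comm,
      mul_one, hG.mul_self, hw, smul_smul, hs, one_smul]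
  let Φ : ℂ →ₐ[ℝ] diagClifford w := Complex.liftAux (a * b) hI
  have hΦI : Φ Complex.I = a * b := Complex.liftAux_apply_I _ hI
  have hab : a * b ∈ (diagClifford w).deg 0 := by
    have := Superalgebra.mul_mem _ (gen_mem w (σ 0)) (gen_mem w (σ 1))
    rwa [show (1 : ZMod 2) + 1 = 0 by decide] at this
  refine isOddGradedDivision Φ (fun d => ?_) (σ 0) (by rwa [hw]) fun i => ?_
  · rw [Complex.liftAux_apply]
    exact add_mem (Superalgebra.algebraMap_mem _ _) (Submodule.smul_mem _ _ hab)
  · obtain ⟨k, rfl⟩ := σ.surjective i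
    fin_cases k
    · exact ⟨1, by simp⟩
    · refine ⟨s • Complex.I, ?_⟩
      change b = a * Φ (s • Complex.I)
      rw [map_smul, hΦI, mul_smul_comm, haa, smul_smul, hs, one_smul]

/-- A definite form in three variables: `D = ℍ`, spanned by the even products of the generators. -/
theorem isOddGradedDivision_three {ι : Type} [Fintype ι] {w : ι → ℝ} (σ : Fin 3 ≃ ι) {s : ℝ}
    (hs : s * s = 1) (hw : ∀ i, w i = s) : (diagClifford w).IsOddGradedDivision := by
  have hs0 : s ≠ 0 := left_ne_zero_of_mul_eq_one hs
  have hG := isCliffordFamily_gen w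
  have h3 : IsCliffordFamily (fun _ => s) fun k => gen w (σ k) := by
    have := hG.comp σ.injective
    simpa only [hw] using this
  let Φ := h3.quaternionHom hs
  refine isOddGradedDivision Φ (IsCliffordFamily.quaternionHom_mem hs h3 fun k => gen_mem _ _)
    (σ 0) (by rwa [hw]) fun i => ?_
  obtain ⟨k, rfl⟩ := σ.surjective i
  have key : ∀ x, Φ x = gen w (σ 0) * gen w (σ k) → gen w (σ k) = gen w (σ 0) * Φ (s • x) := by
    intro x hx
    rw [map_smul, hx, mul_smul_comm, hG.mul_self_assoc, hw, smul_smul, hs, one_smul]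
  fin_cases k
  · exact ⟨1, by simp⟩
  · obtain ⟨x, hx⟩ := h3.exists_quaternionHom_I hs
    exact ⟨_, key x hx⟩
  · obtain ⟨x, hx⟩ := h3.exists_quaternionHom_J hs
    exact ⟨_, key x hx⟩

/-! ### The small Clifford algebras that are not graded division algebras -/

theorem nonempty_fullCorner_of_isEmpty {K ι : Type} [Field K] [CharZero K] [Fintype ι] [IsEmpty ι]
    (w : ι → K) : Nonempty (FullCorner (Superalgebra.concentrated K K) (diagClifford w)) := by
  have := nontrivial (w := w)
  let φ : K →ₐ[K] diagClifford w := Algebra.ofId K _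
  have hinj : Function.Injective φ := (algebraMap K (diagClifford w)).injective
  have hsurj : Function.Surjective φ := by
    refine induction ⟨1, map_one _⟩ ?_ ?_ fun i => isEmptyElim i
    · rintro _ _ ⟨x, rfl⟩ ⟨y, rfl⟩
      exact ⟨x + y, map_add _ _ _⟩
    · rintro k _ ⟨x, rfl⟩
      exact ⟨k • x, map_smul _ _ _⟩
  let E : Superalgebra.concentrated K K ≃ₐ[K] diagClifford w :=
    AlgEquiv.ofBijective φ ⟨hinj, hsurj⟩
  refine ⟨.ofAlgEquiv E fun i b hb => ?_⟩
  obtain rfl | rfl := GrModule.zero_or_one i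
  · exact (diagClifford w).algebraMap_mem (show K from b)
  · rw [Superalgebra.concentrated_deg_one, Submodule.mem_bot] at hb
    rw [hb, map_zero]
    exact zero_mem _

/-- The quaternions are the corner of the Clifford algebra of four generators of square `1` at
`e = (1 + ω) / 2`, where `ω` is the product of the generators. -/
theorem nonempty_fullCorner_quaternion :
    Nonempty (FullCorner (Superalgebra.concentrated ℝ (Quaternion ℝ))
      (diagClifford fun _ : Fin 4 => (1 : ℝ))) := by
  set w : Fin 4 → ℝ := fun _ => 1 with hw
  have := nontrivial (w := w)
  have G : IsCliffordFamily w (gen w) := isCliffordFamily_gen w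
  have h3 : IsCliffordFamily (fun _ => (1 : ℝ)) fun k : Fin 3 => gen w k.castSucc :=
    G.comp (Fin.castSucc_injective 3)
  let Φ := h3.quaternionHom (one_mul 1)
  have hΦm : ∀ x, Φ x ∈ (diagClifford w).deg 0 :=
    IsCliffordFamily.quaternionHom_mem (one_mul 1) h3 fun k => gen_mem _ _
  obtain ⟨I, hI⟩ := h3.exists_quaternionHom_I (one_mul 1)
  obtain ⟨J, hJ⟩ := h3.exists_quaternionHom_J (one_mul 1)
  change Φ I = gen w 0 * gen w 1 at hI
  change Φ J = gen w 0 * gen w 2 at hJ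
  obtain ⟨ω, hω⟩ : ∃ ω, ω = IsCliffordFamily.vol (gen w) := ⟨_, rfl⟩
  have hωω : ω * ω = 1 := hω ▸ G.vol_mul_vol (one_mul 1)
  have hgω : ∀ i, gen w i * ω = -(ω * gen w i) := fun i => hω ▸ G.mul_vol i
  have hωm : ω ∈ (diagClifford w).deg 0 := by
    have := Superalgebra.mul_mem _ (Superalgebra.mul_mem _ (Superalgebra.mul_mem _
      (gen_mem w 0) (gen_mem w 1)) (gen_mem w 2)) (gen_mem w 3)
    rw [show (1 : ZMod 2) + 1 + 1 + 1 = 0 by decide] at this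
    exact hω ▸ this
  obtain ⟨e, he⟩ : ∃ e, e = (2⁻¹ : ℝ) • (1 + ω) := ⟨_, rfl⟩
  have hωe : ω * e = e := by rw [he, mul_smul_comm, mul_add, mul_one, hωω, add_comm]
  have hee : e * e = e := by
    have : e * e = (2⁻¹ : ℝ) • (e + ω * e) := by
      conv_lhs => enter [1]; rw [he]
      rw [smul_mul_assoc, add_mul, one_mul]
    rw [this, hωe, ← two_smul ℝ, smul_smul, inv_mul_cancel₀ two_ne_zero, one_smul]
  have hem : e ∈ (diagClifford w).deg 0 :=
    he ▸ Submodule.smul_mem _ _ (add_mem (Superalgebra.one_mem _) hωm)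
  have hge : ∀ i, gen w i * e = (1 - e) * gen w i := fun i => by
    have h1 : 1 - e = (2⁻¹ : ℝ) • (1 - ω) := by
      rw [he, sub_eq_iff_eq_add, ← smul_add, sub_add_add_cancel, ← two_smul ℝ, smul_smul,
        inv_mul_cancel₀ two_ne_zero, one_smul]
    rw [h1, he, mul_smul_comm, mul_add, hgω, smul_mul_assoc, sub_mul, mul_one, one_mul,
      sub_eq_add_neg]
  have hsq : ∀ i z, gen w i * (gen w i * z) = z := fun i z => by
    rw [G.mul_self_assoc]
    exact one_smul ℝ z
  have hcomm : ∀ d, Φ d * e = e * Φ d := fun d => by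
    have h1 : ∀ i j, Commute (gen w i * gen w j) ω := fun i j => by
      rw [Commute, SemiconjBy, mul_assoc, hgω, mul_neg, ← mul_assoc, hgω, neg_mul, neg_neg,
        mul_assoc]
    have h2 : Commute (Φ d) ω := by
      change Commute (h3.quaternionHom (one_mul 1) d) ω
      rw [IsCliffordFamily.quaternionHom_apply]
      exact (((Algebra.commute_algebraMap_left _ _).add_left ((h1 0 1).smul_left _)).add_left
          ((h1 0 2).smul_left _)).add_left (((h1 0 1).mul_left (h1 0 2)).smul_left _)
    rw [he]
    exact ((Commute.one_right _).add_right h2).smul_right _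
  have hlin : ∀ i, ∃ α, gen w i * e = gen w 0 * (Φ α * e) := fun i => by
    fin_cases i
    · exact ⟨1, by simp⟩
    · exact ⟨I, by rw [hI, mul_assoc, hsq]; rfl⟩
    · exact ⟨J, by rw [hJ, mul_assoc, hsq]; rfl⟩
    · -- Modulo `e` the element `ω` is `1`, which expresses `g₃` through the other generators.
      refine ⟨I * J, ?_⟩
      change gen w 3 * e = _
      conv_lhs => rw [← hωe, hω, IsCliffordFamily.vol]
      rw [map_mul, hI, hJ]
      simp only [mul_assoc, hsq]
      rw [G.swap_assoc 3 0 (by decide), G.swap_assoc 3 1 (by decide), G.swap_assoc 3 2 (by decide),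
        hsq, G.swap_assoc 1 0 (by decide)]
      simp only [mul_neg, neg_neg]
  -- `e = 0` would give `g₀ = (1 - e) g₀ = g₀ e = 0`, although `g₀² = 1`.
  have he0 : e ≠ 0 := fun h => by
    have h1 := hge 0
    rw [h, mul_zero, sub_zero, one_mul] at h1
    have h2 := hsq 0 1
    rw [← h1, zero_mul] at h2
    exact zero_ne_one h2
  have hege : ∀ i, e * (gen w i * e) = 0 := fun i => by
    rw [hge, ← mul_assoc, mul_sub, mul_one, hee, sub_self, zero_mul]
  let φ : Quaternion ℝ →ₗ[ℝ] diagClifford w := (LinearMap.mulRight ℝ e).comp Φ.toLinearMap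
  have hφ : ∀ x, φ x = Φ x * e := fun _ => rfl
  have hφ1 : φ 1 = e := by rw [hφ, map_one, one_mul]
  refine ⟨
    { toFun := φ
      injective := ?_
      map_mul := fun (a b : Quaternion ℝ) => ?_
      map_deg := fun i a ha => ?_
      exists_eq := fun a => ?_
      full := ?_ }⟩
  · refine (injective_iff_map_eq_zero φ).2 fun a ha => ?_
    by_contra h0
    refine he0 ?_
    rw [← one_mul e, ← map_one Φ, ← inv_mul_cancel₀ h0, map_mul, mul_assoc, ← hφ, ha, mul_zero]
  · change φ (a * b) = φ a * φ b
    rw [hφ, hφ, hφ, map_mul, hcomm b, mul_assoc (Φ a) e, ← mul_assoc e e, hee, ← hcomm, mul_assoc]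
  · obtain rfl | rfl := GrModule.zero_or_one i
    · have := Superalgebra.mul_mem _ (hΦm a) hem
      rwa [add_zero] at this
    · rw [Superalgebra.concentrated_deg_one, Submodule.mem_bot] at ha
      have h0 : φ a = 0 := (congrArg φ ha).trans (map_zero φ)
      change φ a ∈ (diagClifford w).deg 1
      rw [h0]
      exact zero_mem _
  · obtain ⟨d, d', hd⟩ := exists_eq_add Φ 0 hcomm hlin a
    refine ⟨d, ?_⟩
    change φ d = φ 1 * a * φ 1
    rw [hφ1, mul_assoc, hd, mul_add, hcomm d', ← mul_assoc (gen w 0), ← mul_assoc e _ (Φ d'), hege,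
      zero_mul, add_zero, hcomm d, ← mul_assoc, hee, hφ, hcomm]
  · change (1 : diagClifford w) ∈ Submodule.span ℝ {z | ∃ i, ∃ a ∈ _, ∃ b ∈ _, z = a * φ 1 * b}
    rw [hφ1, show (1 : diagClifford w) = e + (1 - e) by abel]
    refine add_mem (Submodule.subset_span ⟨0, 1, Superalgebra.one_mem _, 1,
      Superalgebra.one_mem _, ?_⟩) (Submodule.subset_span ⟨1, gen w 0, gen_mem w 0, gen w 0,
      gen_mem w 0, ?_⟩)
    · rw [one_mul, mul_one]
    · have := hsq 0 1
      rw [mul_one] at this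
      rw [hge, mul_assoc, this, mul_one]

end diagClifford

/-! ### Periodicity -/

namespace FullCorner

variable {K : Type} [Field K] {A B C : Superalgebra K}

theorem nonempty_trans (h : Nonempty (FullCorner C B)) (h' : Nonempty (FullCorner B A)) :
    Nonempty (FullCorner C A) :=
  h.elim fun c => h'.elim fun d => ⟨c.trans d⟩

theorem nonempty_refl (A : Superalgebra K) : Nonempty (FullCorner A A) :=
  ⟨.ofAlgEquiv AlgEquiv.refl fun _ _ h => h⟩

end FullCorner

open FullCorner diagClifford

theorem nonempty_fullCorner_realClifford_succ (p q : ℕ) :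
    Nonempty (FullCorner (realClifford p q) (realClifford (p + 1) (q + 1))) := by
  refine nonempty_trans (nonempty_fullCorner_addPlane _) (nonempty_fullCorner_of_equiv
    ((Equiv.sumSumSumComm _ _ _ _).trans (finSumFinEquiv.sumCongr finSumFinEquiv))
    (fun _ => 1) (fun _ => one_ne_zero) ?_)
  rintro ((i | i) | (i | i)) <;> simp [addPlane]

/-- Splits off the last four indices of generators of square `1`. -/
def moveFour (p q : ℕ) : (Fin p ⊕ Fin q) ⊕ Fin 4 ≃ Fin (p + 4) ⊕ Fin q :=
  ((Equiv.sumAssoc _ _ _).trans ((Equiv.refl _).sumCongr (Equiv.sumComm _ _))).trans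
    ((Equiv.sumAssoc _ _ _).symm.trans (finSumFinEquiv.sumCongr (Equiv.refl _)))

/-- Splits off the last four indices of generators of square `-1`. -/
def moveFour' (p q : ℕ) : (Fin p ⊕ Fin q) ⊕ Fin 4 ≃ Fin p ⊕ Fin (q + 4) :=
  (Equiv.sumAssoc _ _ _).trans ((Equiv.refl _).sumCongr finSumFinEquiv)

theorem nonempty_fullCorner_realClifford_add_four_left (p q : ℕ) :
    Nonempty (FullCorner (realClifford p (q + 4)) (realClifford (p + 4) q)) := by
  refine nonempty_trans (nonempty_trans (nonempty_fullCorner_of_equiv (w' := Sum.elim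
    (Sum.elim (fun _ => 1) (fun _ => -1) : Fin p ⊕ Fin q → ℝ) fun _ => -1)
    (moveFour' p q).symm (fun _ => 1) (fun _ => one_ne_zero) ?_)
    (nonempty_fullCorner_neg_four _ (by norm_num))) (nonempty_fullCorner_of_equiv
    (moveFour p q) (fun _ => 1) (fun _ => one_ne_zero) ?_)
  · refine (moveFour' p q).forall_congr_right.1 ?_
    rintro ((i | i) | i) <;> simp [moveFour']
  · rintro ((i | i) | i) <;> simp [moveFour]

theorem nonempty_fullCorner_realClifford_add_four_right (p q : ℕ) :
    Nonempty (FullCorner (realClifford (p + 4) q) (realClifford p (q + 4))) := by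
  refine nonempty_trans (nonempty_trans (nonempty_fullCorner_of_equiv (w' := Sum.elim
    (Sum.elim (fun _ => 1) (fun _ => -1) : Fin p ⊕ Fin q → ℝ) fun _ => 1)
    (moveFour p q).symm (fun _ => 1) (fun _ => one_ne_zero) ?_)
    (nonempty_fullCorner_neg_four _ (by norm_num))) (nonempty_fullCorner_of_equiv
    (moveFour' p q) (fun _ => 1) (fun _ => one_ne_zero) ?_)
  · refine (moveFour p q).forall_congr_right.1 ?_
    rintro ((i | i) | i) <;> simp [moveFour]
  · rintro ((i | i) | i) <;> simp [moveFour']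

/-- Every real Clifford superalgebra has one of eight small ones, with the same value of `p - q`
modulo `8`, as a full corner. -/
theorem exists_small_realClifford (n : ℕ) : ∀ p q : ℕ, p + q = n → ∃ a b : ℕ,
    Nonempty (FullCorner (realClifford a b) (realClifford p q)) ∧
      (p : ℤ) - q ≡ a - b [ZMOD 8] ∧ (b = 0 ∧ a ≤ 4 ∨ a = 0 ∧ b ≤ 3) := by
  induction n using Nat.strong_induction_on with
  | _ n ih =>
    intro p q hn
    obtain ⟨p, q, rfl, rfl⟩ | h : (∃ p' q', p = p' + 1 ∧ q = q' + 1) ∨ (p = 0 ∨ q = 0) := by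
      obtain _ | p := p
      · simp
      · obtain _ | q := q <;> simp
    · obtain ⟨a, b, hc, hmod, hab⟩ := ih (p + q) (by omega) p q rfl
      refine ⟨a, b, nonempty_trans hc (nonempty_fullCorner_realClifford_succ p q), ?_, hab⟩
      convert hmod using 1
      push_cast
      ring
    -- What is left is a definite form. If it has at least five variables, changing four
    -- signs makes it indefinite, and a hyperbolic plane splits off.
    by_cases hsmall : q = 0 ∧ p ≤ 4 ∨ p = 0 ∧ q ≤ 3
    · exact ⟨p, q, nonempty_refl _, rfl, hsmall⟩
    by_cases h4 : q = 4
    · obtain rfl : p = 0 := by omega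
      subst h4
      exact ⟨4, 0, nonempty_fullCorner_realClifford_add_four_right 0 0, by decide, by simp⟩
    obtain rfl | rfl := h
    · obtain ⟨m, rfl⟩ : ∃ m, q = m + 1 + 4 := ⟨q - 5, by omega⟩
      obtain ⟨a, b, hc, hmod, hab⟩ := ih (3 + m) (by omega) 3 m rfl
      refine ⟨a, b, nonempty_trans hc (nonempty_trans (nonempty_fullCorner_realClifford_succ 3 m)
        (nonempty_fullCorner_realClifford_add_four_right 0 (m + 1))), ?_, hab⟩
      refine Int.ModEq.trans ?_ hmod
      rw [Int.modEq_iff_dvd]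
      push_cast
      ring_nf
      exact dvd_refl 8
    · obtain ⟨m, rfl⟩ : ∃ m, p = m + 1 + 4 := ⟨p - 5, by omega⟩
      obtain ⟨a, b, hc, hmod, hab⟩ := ih (m + 3) (by omega) m 3 rfl
      refine ⟨a, b, nonempty_trans hc (nonempty_trans (nonempty_fullCorner_realClifford_succ m 3)
        (nonempty_fullCorner_realClifford_add_four_left (m + 1) 0)), ?_, hab⟩
      refine Int.ModEq.trans ?_ hmod
      rw [Int.modEq_iff_dvd]
      push_cast
      ring_nf
      norm_num

/-- The Clifford algebra determined by `p - q` modulo `8` is a full corner. -/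
theorem nonempty_fullCorner_realClifford {a b : ℕ} (hab : b = 0 ∧ a ≤ 4 ∨ a = 0 ∧ b ≤ 3)
    {p q : ℕ} (h : (p : ℤ) - q ≡ a - b [ZMOD 8]) :
    Nonempty (FullCorner (realClifford a b) (realClifford p q)) := by
  obtain ⟨a', b', hc, hmod, hab'⟩ := exists_small_realClifford _ p q rfl
  have h' := hmod.symm.trans h
  rw [Int.modEq_iff_dvd] at h'
  obtain rfl : a' = a := by omega
  obtain rfl : b' = b := by omega
  exact hc

/-- Over `ℂ`, rescaling a generator by `i` turns `⟨1, 1⟩` into the hyperbolic plane `⟨1, -1⟩`. -/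
theorem nonempty_fullCorner_complexClifford_add_two (p : ℕ) :
    Nonempty (FullCorner (complexClifford p) (complexClifford (p + 2))) := by
  refine nonempty_trans (nonempty_fullCorner_addPlane _) (nonempty_fullCorner_of_equiv
    (((Equiv.refl _).sumCongr finSumFinEquiv).trans finSumFinEquiv)
    (Sum.elim (fun _ => 1) (Sum.elim (fun _ => 1) fun _ => Complex.I)) ?_ ?_)
  · rintro (i | i | i) <;> simp
  · rintro (i | i | i) <;> simp [addPlane]

theorem nonempty_fullCorner_complexClifford (r k : ℕ) :
    Nonempty (FullCorner (complexClifford r) (complexClifford (r + 2 * k))) := by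
  induction k with
  | zero => exact nonempty_refl _
  | succ k ih => exact nonempty_trans ih (nonempty_fullCorner_complexClifford_add_two _)

/-! ### The classification -/

theorem oneIrreducible_of_isOddGradedDivision {K : Type} [Field K] {A B : Superalgebra K}
    (h : B.IsOddGradedDivision) (hc : Nonempty (FullCorner B A)) : OneIrreducible A B :=
  hc.elim fun c =>
    have := h.finiteDimensional
    c.oneIrreducible h.isGradedDivision h.odd_ne_bot

theorem twoIrreducibles_of_divisionRing {K D : Type} [Field K] [DivisionRing D] [Algebra K D]
    [FiniteDimensional K D] {A : Superalgebra K}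
    (hc : Nonempty (FullCorner (Superalgebra.concentrated K D) A)) :
    TwoIrreducibles A (Superalgebra.concentrated K D) :=
  hc.elim fun c =>
    have : FiniteDimensional K (Superalgebra.concentrated K D) :=
      inferInstanceAs (FiniteDimensional K D)
    c.twoIrreducibles Superalgebra.concentrated_isGradedDivision Superalgebra.concentrated_deg_one

theorem nonempty_fullCorner_quaternion_realClifford :
    Nonempty (FullCorner (Superalgebra.concentrated ℝ (Quaternion ℝ)) (realClifford 4 0)) := by
  refine nonempty_trans nonempty_fullCorner_quaternion (nonempty_fullCorner_of_equiv
    (Equiv.sumEmpty (Fin 4) (Fin 0)).symm (fun _ => 1) (fun _ => one_ne_zero) ?_)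
  simp

theorem mainTheorem3 :
    (∀ p q : ℕ,
      ((p : ℤ) - q ≡ 0 [ZMOD 8] →
        TwoIrreducibles (realClifford p q) (Superalgebra.concentrated ℝ ℝ)) ∧
      ((p : ℤ) - q ≡ 1 [ZMOD 8] → OneIrreducible (realClifford p q) (realClifford 1 0)) ∧
      ((p : ℤ) - q ≡ 2 [ZMOD 8] → OneIrreducible (realClifford p q) (realClifford 2 0)) ∧
      ((p : ℤ) - q ≡ 3 [ZMOD 8] → OneIrreducible (realClifford p q) (realClifford 3 0)) ∧
      ((p : ℤ) - q ≡ 4 [ZMOD 8] →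
        TwoIrreducibles (realClifford p q)
          (Superalgebra.concentrated ℝ (Quaternion ℝ))) ∧
      ((p : ℤ) - q ≡ 5 [ZMOD 8] → OneIrreducible (realClifford p q) (realClifford 0 3)) ∧
      ((p : ℤ) - q ≡ 6 [ZMOD 8] → OneIrreducible (realClifford p q) (realClifford 0 2)) ∧
      ((p : ℤ) - q ≡ 7 [ZMOD 8] → OneIrreducible (realClifford p q) (realClifford 0 1))) ∧
    (∀ p : ℕ,
      (Even p →
        TwoIrreducibles (complexClifford p) (Superalgebra.concentrated ℂ ℂ)) ∧
      (Odd p → OneIrreducible (complexClifford p) (complexClifford 1))) := by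
  have hpos : ∀ n : ℕ, ∀ i : Fin n ⊕ Fin 0,
      (Sum.elim (fun _ => 1) (fun _ => -1) : Fin n ⊕ Fin 0 → ℝ) i = 1 := by
    rintro n (i | i)
    exacts [rfl, i.elim0]
  have hneg : ∀ n : ℕ, ∀ i : Fin 0 ⊕ Fin n,
      (Sum.elim (fun _ => 1) (fun _ => -1) : Fin 0 ⊕ Fin n → ℝ) i = -1 := by
    rintro n (i | i)
    exacts [i.elim0, rfl]
  have h1 : (1 : ℝ) * 1 = 1 := one_mul 1
  have h1' : (-1 : ℝ) * -1 = 1 := by norm_num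
  have key : ∀ {a b : ℕ}, (realClifford a b).IsOddGradedDivision →
      (b = 0 ∧ a ≤ 4 ∨ a = 0 ∧ b ≤ 3) → ∀ {p q : ℕ}, (p : ℤ) - q ≡ a - b [ZMOD 8] →
      OneIrreducible (realClifford p q) (realClifford a b) := fun hd hab _ _ h =>
    oneIrreducible_of_isOddGradedDivision hd (nonempty_fullCorner_realClifford hab h)
  refine ⟨fun p q => ⟨fun h => ?_, fun h => ?_, fun h => ?_, fun h => ?_, fun h => ?_, fun h => ?_,
    fun h => ?_, fun h => ?_⟩, fun p => ⟨?_, ?_⟩⟩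
  · exact twoIrreducibles_of_divisionRing (nonempty_trans (nonempty_fullCorner_of_isEmpty _)
      (nonempty_fullCorner_realClifford (a := 0) (b := 0) (by simp) (by simpa using h)))
  · exact key (isOddGradedDivision_one (Equiv.sumEmpty _ _).symm h1 (hpos 1)) (by simp)
      (by simpa using h)
  · exact key (isOddGradedDivision_two (Equiv.sumEmpty _ _).symm h1 (hpos 2)) (by simp)
      (by simpa using h)
  · exact key (isOddGradedDivision_three (Equiv.sumEmpty _ _).symm h1 (hpos 3)) (by simp)
      (by simpa using h)
  · exact twoIrreducibles_of_divisionRing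
      (nonempty_trans nonempty_fullCorner_quaternion_realClifford
        (nonempty_fullCorner_realClifford (a := 4) (b := 0) (by simp) (by simpa using h)))
  · exact key (isOddGradedDivision_three (Equiv.emptySum _ _).symm h1' (hneg 3)) (by simp)
      (h.trans (by decide))
  · exact key (isOddGradedDivision_two (Equiv.emptySum _ _).symm h1' (hneg 2)) (by simp)
      (h.trans (by decide))
  · exact key (isOddGradedDivision_one (Equiv.emptySum _ _).symm h1' (hneg 1)) (by simp)
      (h.trans (by decide))
  · rintro ⟨k, rfl⟩
    have := nonempty_fullCorner_complexClifford 0 k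
    rw [zero_add, two_mul] at this
    exact twoIrreducibles_of_divisionRing (nonempty_trans (nonempty_fullCorner_of_isEmpty _) this)
  · rintro ⟨k, rfl⟩
    have := nonempty_fullCorner_complexClifford 1 k
    rw [add_comm] at this
    exact oneIrreducible_of_isOddGradedDivision
      (isOddGradedDivision_one (Equiv.refl _) (one_mul (1 : ℂ)) fun _ => rfl) this
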